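/- Let $n\ge 2$, $m\in\{2,\dots,n\}$, and consider on the half-line $x\ge 0$ the system $$\mathbf y'=\big(\lambda F(x)+A(x)+C(x,\lambda)\big)\mathbf y,\qquad \mathbf y=[y_j(x)]_{j=1}^n,\quad \lambda\in\mathbb C\setminus\{0\},$$ where: (I) $F(x)=\rho(x)\,\mathrm{diag}\{b_j\}_{j=1}^n$, with $\rho\in L[0,T)$ for every $T>0$, $\rho>0$ a.e., and $b_1,\dots,b_n$ the $n$-th roots of unity numbered as $b_{2s+1}=e^{2\pi i s/n}$ $(0\le s\le\lfloor\frac{n-1}{2}\rfloor)$, $b_{2p}=e^{-2\pi i p/n}$ $(1\le p\le\lfloor\frac n2\rfloor)$; put $b_{n+1}:=b_n$; (II) $A=[a_{jk}]_{j,k=1}^n$ with $a_{jk}\in L[0,\infty)$; (III) $C(x,\lambda)=[c_{jk}(x,\lambda)]_{j,k=1}^n$, where each $\lambda\mapsto c_{jk}(\cdot,\lambda)$ is a holomorphic mapping from $\mathbb C\setminus\{0\}$ to the Banach space $L[0,\infty)$ and $\max_{j,k}\|c_{jk}(\cdot,\lambda)\|_{L[0,\infty)}\to0$ as $\lambda\to\infty$.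 A solution is a vector function whose components are absolutely continuous on $[0,T]$ for every $T>0$ and which satisfies the system for a.e. $x\ge 0$. Put $p(x)=\int_0^x\rho(t)\,dt$, $$\Gamma_\kappa=\Big\{\lambda\ne0:\tfrac{\pi(\kappa-1)}n<\arg\lambda<\tfrac{\pi\kappa}n\Big\},\ \kappa=1,\dots,2n,\qquad \sigma=\begin{cases}2n,& m\text{ even},\\ 2,& m\text{ odd},\end{cases}$$ $$\Omega_m=\Big\{\lambda\neq 0:\ [(-1)^{m-1}-1]\tfrac{\pi}{2n}<\arg\lambda<[(-1)^{m-1}+3]\tfrac{\pi}{2n}\Big\},$$ with arguments understood modulo $2\pi$, so that $\overline{\Omega_m}=\overline{\Gamma_1}\cup\overline{\Gamma_\sigma}$. Then there are numbers $\lambda_\alpha>0$, $\alpha\ge0$, such that for every $\alpha\ge 0$, with $S^\alpha:=\{\lambda\in S:|\lambda|>\lambda_\alpha\}$ for $S=\Omega_m,\Gamma_1,\Gamma_\sigma$, there exists for $\lambda\in\overline{\Omega_m^\alpha}$ a system of $n-m+1$ solutions $[u_{jk}(x,\lambda)]_{j=1}^n$, $k=m,\dots,n$, with the following properties. 1. There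 is a constant $N_\alpha$ such that for all $j=1,\dots,n$, $k=m,\dots,n$ and $x\ge\alpha$, $$|u_{jk}(x,\lambda)|\le N_\alpha\big|e^{\lambda b_m(p(x)-p(\alpha))}\big|,\ \lambda\in\overline{\Gamma_1^\alpha},\qquad |u_{jk}(x,\lambda)|\le N_\alpha\big|e^{\lambda b_{m+1}(p(x)-p(\alpha))}\big|,\ \lambda\in\overline{\Gamma_\sigma^\alpha}.$$ 2. For every fixed $x\ge0$, the functions $u_{jk}(x,\cdot)$, $j=1,\dots,n$, $k=m,\dots,n$, are continuous on $\overline{\Omega_m^\alpha}$ and analytic in $\Omega_m^\alpha$. 3. $u_{jk}(\alpha,\lambda)=\delta_{jk}$ for $j,k=m,\dots,n$ and $\lambda\in\overline{\Omega_m^\alpha}$. Moreover, if there is a function $\varphi(\alpha)>0$, $\alpha\ge0$, such that $\varphi(\alpha)\to0$ and $\sup_{|\lambda|\ge\varphi(\alpha)}\max_{j,k}\|c_{jk}(\cdot,\lambda)\|_{L[\alpha,\infty)}\to0$ as $\alpha\to\infty$, then the $\lambda_\alpha$ can be chosen so that $\lambda_\alpha\to0$ as $\alpha\to\infty$. -/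

import Mathlib

open MeasureTheory Set Filter Topology
open scoped Matrix

namespace LargeSector

/-- The complex Banach space `L[0, ∞)` of (classes of) summable functions on the half-line. -/
abbrev L1HalfLine : Type := Lp ℂ 1 (volume.restrict (Ici (0 : ℝ)))

/-- The function `p(x) = ∫₀ˣ ρ(t) dt`. -/
noncomputable def primitive (ρ : ℝ → ℝ) (x : ℝ) : ℝ := ∫ t in (0 : ℝ)..x, ρ t

/-- The coefficient matrix `λ F(x) + A(x) + C(x, λ)` with `F(x) = ρ(x) diag(b)`; here `z` is the
spectral parameter `λ`. -/
noncomputable def coeffMatrix {n : ℕ} (ρ : ℝ → ℝ) (b : Fin n → ℂ)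
    (A : ℝ → Matrix (Fin n) (Fin n) ℂ) (C : ℂ → Matrix (Fin n) (Fin n) L1HalfLine)
    (z : ℂ) (x : ℝ) : Matrix (Fin n) (Fin n) ℂ :=
  z • ((ρ x : ℂ) • Matrix.diagonal b) + A x + Matrix.of (fun j k => (C z j k : ℝ → ℂ) x)

/-- `y` solves `y' = (λ F(x) + A(x) + C(x, λ)) y` on the half-line `x ≥ 0`: the components of `y`
are absolutely continuous on every `[0, T]`, and the equation holds almost everywhere. -/
def IsSolution {n : ℕ} (ρ : ℝ → ℝ) (b : Fin n → ℂ)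
    (A : ℝ → Matrix (Fin n) (Fin n) ℂ) (C : ℂ → Matrix (Fin n) (Fin n) L1HalfLine)
    (z : ℂ) (y : ℝ → Fin n → ℂ) : Prop :=
  (∀ T : ℝ, 0 < T → ∀ j, AbsolutelyContinuousOnInterval (fun x => y x j) 0 T) ∧
  ∀ᵐ x ∂(volume.restrict (Ici (0 : ℝ))), HasDerivAt y (coeffMatrix ρ b A C z x *ᵥ y x) x

/-- The `n`-th roots of unity in the fixed numeration, with the index `j = 1, …, n` starting
from one: `b_{2s+1} = exp(2πis/n)` and `b_{2p} = exp(-2πip/n)`. -/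
noncomputable def rootOfUnity (n j : ℕ) : ℂ :=
  if Odd j then Complex.exp (2 * Real.pi * Complex.I * ((j / 2 : ℕ) : ℂ) / n)
  else Complex.exp (-(2 * Real.pi * Complex.I * ((j / 2 : ℕ) : ℂ) / n))

/-- The open sector `{λ ≠ 0 : β₁ < arg λ < β₂}`, where the argument is understood modulo `2π`. -/
def sector (β₁ β₂ : ℝ) : Set ℂ :=
  {z | ∃ r t : ℝ, 0 < r ∧ β₁ < t ∧ t < β₂ ∧ z = r * Complex.exp (t * Complex.I)}

/-- The sector `Γ_κ`: `π(κ-1)/n < arg λ < πκ/n`. -/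
noncomputable def Gam (n κ : ℕ) : Set ℂ :=
  sector (Real.pi * ((κ : ℝ) - 1) / n) (Real.pi * (κ : ℝ) / n)

/-- The index `σ` of the sector neighboring to `Γ₁`: `σ = 2n` for even `m`, `σ = 2` for odd `m`. -/
def sig (n m : ℕ) : ℕ := if Even m then 2 * n else 2

/-- The large sector `Ω_m`. -/
noncomputable def Om (n m : ℕ) : Set ℂ :=
  sector (((-1 : ℝ) ^ (m - 1) - 1) * Real.pi / (2 * n))
    (((-1 : ℝ) ^ (m - 1) + 3) * Real.pi / (2 * n))

/-- The part `{λ ∈ S : |λ| > r}` of a set `S`. -/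
def outer (S : Set ℂ) (r : ℝ) : Set ℂ := {z | z ∈ S ∧ r < ‖z‖}

/-- The norm `‖C(·, λ)‖` in `L[α, ∞)`, `α ≥ 0`: the maximum over the entries of their
`L¹`-norms on `[α, ∞)`. -/
noncomputable def tailNorm {n : ℕ} (C : ℂ → Matrix (Fin n) (Fin n) L1HalfLine)
    (α : ℝ) (z : ℂ) : ENNReal :=
  ⨆ j : Fin n, ⨆ k : Fin n, ∫⁻ x in Ici α, ‖(C z j k : ℝ → ℂ) x‖ₑ

/-- There is `φ(α) > 0`, `α ≥ 0`, with `φ(α) → 0` and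
`sup_{|λ| ≥ φ(α)} ‖C(·, λ)‖_{L[α, ∞)} → 0` as `α → ∞`. -/
def TailCondition {n : ℕ} (C : ℂ → Matrix (Fin n) (Fin n) L1HalfLine) : Prop :=
  ∃ φ : ℝ → ℝ, (∀ α, 0 ≤ α → 0 < φ α) ∧ Tendsto φ atTop (𝓝 0) ∧
    Tendsto (fun α => ⨆ z : {z : ℂ // φ α ≤ ‖z‖}, tailNorm C α z) atTop (𝓝 0)

end LargeSector

/-! Put `θ_j(x) = λ b_j p(x) + ∫₀ˣ a_jj`. Variation of constants with these exponents turns the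
system on `[α, ∞)` into `u = f + T u`, where the remaining coefficients `Q` are the off-diagonal
part of `A` plus all of `C`. Components with index at least `m` are integrated from `α`, the others
from infinity. This one choice serves all of `Ω_m`: there `Re(λ b_k) ≤ Re(λ b_j)` whenever `j < m ≤
k` (`re_le_re_of_mem_Om`). Crossing the ray between `Γ_1` and `Γ_σ` may change the order inside the
two groups, but not their separation. With `μ(λ) = max_{k ≥ m} Re(λ b_k)` and the weight `exp(μ
(p(x) - p(α)))`, the kernel of `T` is bounded independently of `λ` (`norm_fker_mul_wt_le`). The
maximum is attained at `b_m` on `Γ_1` and at `b_{m+1}` on `Γ_σ`, which gives the two exponential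
estimates.

For fixed `α` the operator `T` is bounded but need not be a contraction, since the off-diagonal part
of `A` need not be small. Its square is small for large `|λ|`. The contribution of `C` is small by
hypothesis. An off-diagonal entry of `A` is approximated in `L¹` by `g ρ` with `g` smooth and
compactly supported (`exists_smooth_mul_approx`). As `b_l ≠ b_j`, the factor `ρ exp(θ_l - θ_j)` is,
up to terms without `λ`, a derivative divided by `λ (b_l - b_j)`, so integration by parts gains
`1/|λ|` (`norm_mul_integral_le`). Hence the Neumann series converges, and `exists_fixedPoint_kerOp`
carries continuity and holomorphy in `λ` to its sum. At `x = α` the integrals from `α` vanish, which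
gives the initial values.

On `[0, α]` the solutions are continued by a Volterra equation with the values at `α` as data; a
Gronwall weight makes its operator a contraction for every `λ ≠ 0` (`exists_backward`).

For the last assertion, the tail condition makes `T` itself a contraction for large `α` and `|λ| ≥
φ(α)`, without any oscillation argument (`eventually_contractive`), so `λ_α = φ(α)` is eventually
admissible. -/

namespace LargeSector

/-! ### Calculus of absolutely continuous complex functions -/

/-- `f` is absolutely continuous on the interval between `a` and `b`, with almost everywhere
derivative `f'`. -/
structure HasAEDeriv (f f' : ℝ → ℂ) (a b : ℝ) : Prop where
  ac : AbsolutelyContinuousOnInterval f a b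
  int : IntervalIntegrable f' volume a b
  deriv : ∀ᵐ x, x ∈ uIcc a b → HasDerivAt f (f' x) x

/-- Absolute continuity is a condition on sums of increments, so domination of the increments is
enough. The dominating function may take values in another space: a complex primitive is compared
with the real primitive of the norm. -/
theorem absolutelyContinuousOnInterval_of_dist_le {X Y : Type*} [PseudoMetricSpace X]
    [PseudoMetricSpace Y] {f : ℝ → X} {g : ℝ → Y} {a b : ℝ}
    (hg : AbsolutelyContinuousOnInterval g a b) (K : ℝ)
    (h : ∀ x ∈ uIcc a b, ∀ y ∈ uIcc a b, dist (f x) (f y) ≤ K * dist (g x) (g y)) :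
    AbsolutelyContinuousOnInterval f a b := by
  have h0 := Tendsto.const_mul K hg
  rw [mul_zero] at h0
  refine squeeze_zero' (Eventually.of_forall fun E => Finset.sum_nonneg fun i _ => dist_nonneg)
    ?_ h0
  filter_upwards [mem_inf_of_right (mem_principal_self _)] with E hE
  rw [Finset.mul_sum]
  exact Finset.sum_le_sum fun i hi => h _ (hE.1 i hi).1 _ (hE.1 i hi).2

namespace HasAEDeriv

variable {f f' g g' : ℝ → ℂ} {a b : ℝ}

theorem primitive (hf : IntervalIntegrable f volume a b) (c : ℝ) (hc : c ∈ uIcc a b) (κ : ℂ) :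
    HasAEDeriv (fun x => κ + ∫ t in c..x, f t) f a b := by
  refine ⟨?_, hf, ?_⟩
  · refine absolutelyContinuousOnInterval_of_dist_le
      (hf.norm.absolutelyContinuousOnInterval_intervalIntegral (c := a) (by simp)) 1 ?_
    intro x hx y hy
    have hi : ∀ u ∈ uIcc a b, ∀ v ∈ uIcc a b, IntervalIntegrable f volume u v :=
      fun u hu v hv => hf.mono_set (uIcc_subset_uIcc hu hv)
    rw [dist_add_left, one_mul, dist_eq_norm, Real.dist_eq,
      intervalIntegral.integral_interval_sub_left (hi _ hc _ hx) (hi _ hc _ hy),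
      intervalIntegral.integral_interval_sub_left (hi _ (by simp) _ hx).norm
        (hi _ (by simp) _ hy).norm]
    exact intervalIntegral.norm_integral_le_abs_integral_norm
  · filter_upwards [hf.ae_hasDerivAt_integral] with x hx hxm
    exact (hx hxm c hc).const_add κ

theorem mul (hf : HasAEDeriv f f' a b) (hg : HasAEDeriv g g' a b) :
    HasAEDeriv (fun x => f x * g x) (fun x => f' x * g x + f x * g' x) a b := by
  refine ⟨hf.ac.smul hg.ac, ?_, ?_⟩
  · exact (hf.int.mul_continuousOn hg.ac.continuousOn).add
      (hg.int.continuousOn_mul hf.ac.continuousOn)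
  · filter_upwards [hf.deriv, hg.deriv] with x h1 h2 hx
    exact (h1 hx).mul (h2 hx)

theorem cexp (hf : HasAEDeriv f f' a b) :
    HasAEDeriv (fun x => Complex.exp (f x)) (fun x => Complex.exp (f x) * f' x) a b := by
  have hcont : ContinuousOn (fun x => Complex.exp (f x)) (uIcc a b) := hf.ac.continuousOn.cexp
  refine ⟨?_, hf.int.continuousOn_mul hcont, ?_⟩
  · obtain ⟨R, hR⟩ := hf.ac.exists_bound
    refine absolutelyContinuousOnInterval_of_dist_le hf.ac (Real.exp R) ?_
    intro x hx y hy
    rw [dist_eq_norm, dist_eq_norm]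
    -- On the ball of radius `R`, which contains the range of `f`, the exponential is Lipschitz with
    -- constant `e^R`.
    refine (convex_closedBall (0 : ℂ) R).norm_image_sub_le_of_norm_hasDerivWithin_le
      (f := Complex.exp) (f' := Complex.exp)
      (fun w _ => (Complex.hasDerivAt_exp w).hasDerivWithinAt) ?_ ?_ ?_
    · intro w hw
      rw [Complex.norm_exp]
      exact Real.exp_le_exp.2 ((Complex.re_le_norm w).trans (by simpa using hw))
    · simpa using hR y hy
    · simpa using hR x hx
  · filter_upwards [hf.deriv] with x h1 hx
    exact (h1 hx).cexp

theorem mono (hf : HasAEDeriv f f' a b) {c d : ℝ} (h : uIcc c d ⊆ uIcc a b) :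
    HasAEDeriv f f' c d :=
  ⟨hf.ac.mono h, hf.int.mono_set h, hf.deriv.mono fun _ hx hm => hx (h hm)⟩

/-- The difference between `f` and the primitive of `f'` is absolutely continuous with derivative
zero almost everywhere, hence constant. -/
theorem integral_eq_sub (hf : HasAEDeriv f f' a b) : ∫ x in a..b, f' x = f b - f a := by
  have hp := primitive hf.int a (by simp) 0
  have h0 : ∀ᵐ x, x ∈ uIcc a b → HasDerivAt (fun x => f x - (0 + ∫ t in a..x, f' t)) 0 x := by
    filter_upwards [hf.deriv, hp.deriv] with x h1 h2 hx
    simpa using (h1 hx).fun_sub (h2 hx)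
  obtain ⟨C, hC⟩ := (hf.ac.sub hp.ac).const_of_ae_hasDerivAt_zero h0
  have h1 := hC a (by simp)
  have h2 := hC b (by simp)
  simp only [Pi.sub_apply, intervalIntegral.integral_same] at h1 h2
  linear_combination h1 - h2

end HasAEDeriv

/-- The Gronwall type identity behind exponentially weighted norms. -/
theorem integral_mul_exp_integral_le {q : ℝ → ℝ} {x a κ : ℝ} (hκ : 0 < κ)
    (hq : IntervalIntegrable q volume x a) :
    ∫ t in x..a, q t * Real.exp (κ * ∫ s in t..a, q s) ≤
      Real.exp (κ * ∫ s in x..a, q s) / κ := by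
  have hqc : IntervalIntegrable (fun t => (-κ * q t : ℂ)) volume x a :=
    IntervalIntegrable.const_mul ⟨hq.1.ofReal, hq.2.ofReal⟩ _
  have h1 := (HasAEDeriv.primitive hqc a (by simp) 0).cexp
  have h2 := h1.integral_eq_sub
  have h3 : ∀ t, Complex.exp (0 + ∫ s in a..t, (-κ * q s : ℂ)) =
      (Real.exp (κ * ∫ s in t..a, q s) : ℂ) := by
    intro t
    rw [intervalIntegral.integral_symm, intervalIntegral.integral_const_mul,
      intervalIntegral.integral_ofReal]
    push_cast
    congr 1
    ring
  simp only [h3] at h2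
  have h4 : ∫ t in x..a, ((Real.exp (κ * ∫ s in t..a, q s) : ℂ) * (-κ * q t)) =
      ((-κ * ∫ t in x..a, q t * Real.exp (κ * ∫ s in t..a, q s) : ℝ) : ℂ) := by
    rw [← intervalIntegral.integral_const_mul, ← intervalIntegral.integral_ofReal]
    congr 1
    ext t
    push_cast
    ring
  rw [h4, intervalIntegral.integral_same, mul_zero, Real.exp_zero] at h2
  norm_cast at h2
  -- The integral equals `(exp(κ ∫ q) - 1) / κ` exactly; the `-1` is dropped.
  rw [le_div_iff₀ hκ]
  linarith

/-! ### Continuity and holomorphy of integrals against an `L¹`-valued map -/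

section Pairing

variable {ν : Measure ℝ} {q : ℂ → Lp ℂ 1 ν} {h : ℂ → ℝ → ℂ} {S : Set ℂ} {z₀ : ℂ}

theorem integrable_mul_Lp {h : ℝ → ℂ} (hm : AEStronglyMeasurable h ν) {M : ℝ}
    (hM : ∀ t, ‖h t‖ ≤ M) (f : Lp ℂ 1 ν) : Integrable (fun t => h t * f t) ν :=
  (L1.integrable_coeFn f).bdd_mul hm (Eventually.of_forall hM)

theorem norm_integral_mul_Lp_le {h : ℝ → ℂ} {M : ℝ} (hM : ∀ t, ‖h t‖ ≤ M) (f : Lp ℂ 1 ν) :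
    ‖∫ t, h t * f t ∂ν‖ ≤ M * ‖f‖ := by
  rw [L1.norm_eq_integral_norm, ← integral_const_mul]
  refine norm_integral_le_of_norm_le ((L1.integrable_coeFn f).norm.const_mul M)
    (Eventually.of_forall fun t => ?_)
  rw [norm_mul]
  exact mul_le_mul_of_nonneg_right (hM t) (norm_nonneg _)

/-- Continuity of the pairing of an `L¹`-valued map with a pointwise continuous, locally bounded
family of functions. -/
theorem continuousWithinAt_pairing (hq : ContinuousWithinAt q S z₀)
    (hm : ∀ z ∈ S, AEStronglyMeasurable (h z) ν)
    (hc : ∀ t, ContinuousWithinAt (fun z => h z t) S z₀) {M : ℝ}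
    (hM : ∀ᶠ z in 𝓝[S] z₀, ∀ t, ‖h z t‖ ≤ M) :
    ContinuousWithinAt (fun z => ∫ t, h z t * q z t ∂ν) S z₀ := by
  -- Split `q z = (q z - q z₀) + q z₀`: the first part tends to zero in norm, the second is handled
  -- by dominated convergence.
  have h1 : Tendsto (fun z => ∫ t, h z t * (q z - q z₀ : Lp ℂ 1 ν) t ∂ν) (𝓝[S] z₀) (𝓝 0) := by
    have h0 : Tendsto (fun z => M * ‖q z - q z₀‖) (𝓝[S] z₀) (𝓝 0) := by
      have := ((hq.sub (continuousWithinAt_const (b := q z₀))).norm.const_mul M)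
      simpa [ContinuousWithinAt] using this
    refine squeeze_zero_norm' ?_ h0
    filter_upwards [hM] with z hz
    exact norm_integral_mul_Lp_le hz _
  have h2 : Tendsto (fun z => ∫ t, h z t * q z₀ t ∂ν) (𝓝[S] z₀)
      (𝓝 (∫ t, h z₀ t * q z₀ t ∂ν)) := by
    refine tendsto_integral_filter_of_dominated_convergence (fun t => M * ‖q z₀ t‖) ?_ ?_ ?_ ?_
    · filter_upwards [self_mem_nhdsWithin] with z hz
      exact (hm z hz).mul (Lp.aestronglyMeasurable _)
    · filter_upwards [hM] with z hz
      refine Eventually.of_forall fun t => ?_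
      rw [norm_mul]
      exact mul_le_mul_of_nonneg_right (hz t) (norm_nonneg _)
    · exact (L1.integrable_coeFn _).norm.const_mul M
    · exact Eventually.of_forall fun t => (hc t).mul continuousWithinAt_const
  have h3 := h1.add h2
  rw [zero_add] at h3
  refine h3.congr' ?_
  filter_upwards [hM, self_mem_nhdsWithin] with z hz hzS
  rw [← integral_add (integrable_mul_Lp (hm z hzS) hz _) (integrable_mul_Lp (hm z hzS) hz _)]
  refine integral_congr_ae ?_
  filter_upwards [Lp.coeFn_sub (q z) (q z₀)] with t ht
  rw [ht, Pi.sub_apply]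
  ring

/-- Holomorphy of the pairing of a holomorphic `L¹`-valued map with a pointwise holomorphic,
locally bounded family of functions. -/
theorem differentiableAt_pairing {U : Set ℂ} (hU : IsOpen U) (hz₀ : z₀ ∈ U)
    (hq : DifferentiableOn ℂ q U) (hm : ∀ z ∈ U, AEStronglyMeasurable (h z) ν)
    (hd : ∀ t, DifferentiableOn ℂ (fun z => h z t) U) {M : ℝ}
    (hM : ∀ᶠ z in 𝓝 z₀, ∀ t, ‖h z t‖ ≤ M) :
    DifferentiableAt ℂ (fun z => ∫ t, h z t * q z t ∂ν) z₀ := by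
  obtain ⟨r, hr, hball⟩ := Metric.eventually_nhds_iff_ball.1 (hM.and (hU.mem_nhds hz₀))
  have hmem : Metric.ball z₀ r ∈ 𝓝 z₀ := Metric.ball_mem_nhds z₀ hr
  have hz₀b : z₀ ∈ Metric.ball z₀ r := Metric.mem_ball_self hr
  have hqd : DifferentiableAt ℂ q z₀ := hq.differentiableAt (hU.mem_nhds hz₀)
  have hhd : ∀ t, DifferentiableAt ℂ (fun z => h z t) z₀ :=
    fun t => (hd t).differentiableAt (hU.mem_nhds hz₀)
  have hslope : ∀ t z, z ≠ z₀ →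
      dslope (fun z => h z t) z₀ z = (z - z₀)⁻¹ * (h z t - h z₀ t) := by
    intro t z hz
    rw [dslope_of_ne _ hz, slope_def_module, smul_eq_mul]
  -- A Schwarz type bound: on the ball `h` stays within `2M` of its value at the centre, so its
  -- difference quotients are bounded uniformly in `t`.
  have hbd : ∀ z ∈ Metric.ball z₀ r, ∀ t, ‖dslope (fun z => h z t) z₀ z‖ ≤ 2 * M / r := by
    intro z hz t
    refine Complex.norm_dslope_le_div_of_mapsTo_ball
      ((hd t).mono fun w hw => (hball w hw).2) ?_ hz
    intro w hw
    rw [mem_closedBall_iff_norm]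
    exact (norm_sub_le _ _).trans (by linarith [(hball w hw).1 t, (hball z₀ hz₀b).1 t])
  have hmeas : ∀ z ∈ Metric.ball z₀ r,
      AEStronglyMeasurable (fun t => dslope (fun z => h z t) z₀ z) ν := by
    have hne : ∀ z ∈ Metric.ball z₀ r, z ≠ z₀ →
        AEStronglyMeasurable (fun t => dslope (fun z => h z t) z₀ z) ν := by
      intro z hz hzz
      simp only [hslope _ z hzz]
      exact ((hm z (hball z hz).2).sub (hm z₀ hz₀)).const_mul _
    intro z hz
    rcases eq_or_ne z z₀ with rfl | hzz
    -- At the centre the slope is a derivative in `z`. It is measurable in `t` as the limit of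
    -- difference quotients along a sequence.
    · have : (𝓝[≠] z).NeBot := inferInstance
      obtain ⟨u, hu⟩ := exists_seq_tendsto (𝓝[≠] z)
      have hu1 : ∀ᶠ i in atTop, u i ∈ Metric.ball z r ∧ u i ≠ z :=
        hu.eventually (Eventually.and (mem_nhdsWithin_of_mem_nhds hmem) self_mem_nhdsWithin)
      obtain ⟨N, hN⟩ := eventually_atTop.1 hu1
      refine aestronglyMeasurable_of_tendsto_ae atTop
        (f := fun i t => dslope (fun z => h z t) z (u (i + N)))
        (fun i => hne _ (hN _ (by omega)).1 (hN _ (by omega)).2)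
        (Eventually.of_forall fun t => ?_)
      have hcont : ContinuousAt (dslope (fun z => h z t) z) z := continuousAt_dslope_same.2 (hhd t)
      exact (hcont.tendsto.comp (hu.mono_right nhdsWithin_le_nhds)).comp (tendsto_add_atTop_nat N)
    · exact hne z hz hzz
  -- By the product rule for differences, `G` equals the difference quotient of the pairing off
  -- `z₀`. Being continuous at `z₀`, it supplies the derivative there.
  set G : ℂ → ℂ := fun z => (∫ t, h z t * dslope q z₀ z t ∂ν) +
    ∫ t, dslope (fun z => h z t) z₀ z * q z₀ t ∂ν with hG
  have hGc : ContinuousAt G z₀ := by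
    have h1 := continuousWithinAt_pairing (q := dslope q z₀) (S := Metric.ball z₀ r)
      (continuousAt_dslope_same.2 hqd).continuousWithinAt (fun z hz => hm z (hball z hz).2)
      (fun t => (hhd t).continuousAt.continuousWithinAt) (mem_nhdsWithin_of_mem_nhds hM)
    have h2 := continuousWithinAt_pairing (q := fun _ => q z₀)
      (h := fun z t => dslope (fun z => h z t) z₀ z) (S := Metric.ball z₀ r)
      continuousWithinAt_const hmeas
      (fun t => (continuousAt_dslope_same.2 (hhd t)).continuousWithinAt)
      (M := 2 * M / r) (by filter_upwards [self_mem_nhdsWithin] with z hz using hbd z hz)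
    exact (h1.add h2).continuousAt hmem
  refine HasDerivAt.differentiableAt (f' := G z₀) ?_
  rw [hasDerivAt_iff_tendsto_slope]
  refine (hGc.tendsto.mono_left nhdsWithin_le_nhds).congr' ?_
  filter_upwards [mem_nhdsWithin_of_mem_nhds hmem, self_mem_nhdsWithin] with z hz hzz
  have hzz : z ≠ z₀ := hzz
  have hI := fun w (hw : w ∈ Metric.ball z₀ r) v =>
    integrable_mul_Lp (hm w (hball w hw).2) (hball w hw).1 v
  rw [hG, slope_def_module, smul_eq_mul]
  simp only
  rw [← integral_add (hI z hz _) (integrable_mul_Lp (hmeas z hz) (hbd z hz) _),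
    ← integral_sub (hI z hz _) (hI z₀ hz₀b _), ← integral_const_mul]
  refine integral_congr_ae ?_
  rw [dslope_of_ne _ hzz, slope_def_module]
  filter_upwards [Lp.coeFn_sub (q z) (q z₀), Lp.coeFn_smul (z - z₀)⁻¹ (q z - q z₀)] with t h1 h2
  rw [h2, Pi.smul_apply, h1, Pi.sub_apply, hslope t z hzz, smul_eq_mul]
  ring

end Pairing

/-! ### Successive approximations with a parameter -/

section Picard

variable {n : ℕ} {ν : Measure ℝ} [SFinite ν]

/-- The integral operator with scalar kernels `k j z x t` composed with the matrix `q z`. -/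
noncomputable def kerOp (k : Fin n → ℂ → ℝ → ℝ → ℂ) (q : ℂ → Fin n → Fin n → Lp ℂ 1 ν) (z : ℂ)
    (w : ℝ → Fin n → ℂ) : ℝ → Fin n → ℂ :=
  fun x j => ∑ l, ∫ t, k j z x t * w t l * q z j l t ∂ν

variable {k : Fin n → ℂ → ℝ → ℝ → ℂ} {q : ℂ → Fin n → Fin n → Lp ℂ 1 ν}

theorem measurable_kerOp {z : ℂ} (hk : ∀ j, Measurable (Function.uncurry (k j z)))
    {w : ℝ → Fin n → ℂ} (hw : ∀ l, Measurable fun x => w x l) (j : Fin n) :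
    Measurable fun x => kerOp k q z w x j := by
  refine Finset.measurable_fun_sum _ fun l _ => ?_
  refine (StronglyMeasurable.integral_prod_right (ν := ν)
    (f := fun x t => k j z x t * w t l * q z j l t) ?_).measurable
  refine Measurable.stronglyMeasurable ?_
  exact ((hk j).mul ((hw l).comp measurable_snd)).mul
    ((Lp.stronglyMeasurable (q z j l)).measurable.comp measurable_snd)

/-- Successive approximations for `u = f + T u`, where `T` is an integral operator depending on a
parameter. -/
theorem exists_fixedPoint_kerOp {S U : Set ℂ} (hU : IsOpen U) (hUS : U ⊆ S) {W : ℂ → ℝ → ℝ}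
    (hW : ∀ z x, 0 ≤ W z x)
    (hqS : ∀ j l, ContinuousOn (fun z => q z j l) S)
    (hqU : ∀ j l, DifferentiableOn ℂ (fun z => q z j l) U)
    (hkm : ∀ z ∈ S, ∀ j, Measurable (Function.uncurry (k j z)))
    (hkS : ∀ j x t, ContinuousOn (fun z => k j z x t) S)
    (hkU : ∀ j x t, DifferentiableOn ℂ (fun z => k j z x t) U)
    (hloc : ∀ x, ∀ z₀ ∈ S, ∃ M, ∀ᶠ z in 𝓝[S] z₀,
      W z x ≤ M ∧ ∀ t j, ‖k j z x t‖ * W z t ≤ M)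
    {B : ℝ} (hB0 : 0 ≤ B)
    (hB : ∀ z ∈ S, ∀ w : ℝ → Fin n → ℂ, (∀ j, Measurable fun x => w x j) → ∀ a, 0 ≤ a →
      (∀ x j, ‖w x j‖ ≤ a * W z x) →
      (∀ x j, ‖kerOp k q z w x j‖ ≤ a * B * W z x) ∧
      ∀ x j, ‖kerOp k q z (kerOp k q z w) x j‖ ≤ a / 2 * W z x)
    {f : ℂ → ℝ → Fin n → ℂ} {A₀ : ℝ} (hA₀ : 0 ≤ A₀)
    (hfm : ∀ z ∈ S, ∀ j, Measurable fun x => f z x j)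
    (hfb : ∀ z ∈ S, ∀ x j, ‖f z x j‖ ≤ A₀ * W z x)
    (hfS : ∀ x j, ContinuousOn (fun z => f z x j) S)
    (hfU : ∀ x j, DifferentiableOn ℂ (fun z => f z x j) U) :
    ∃ u : ℂ → ℝ → Fin n → ℂ, (∀ z ∈ S, ∀ j, Measurable fun x => u z x j) ∧
      (∀ z ∈ S, ∀ x j, ‖u z x j‖ ≤ 8 * A₀ * (1 + B) * W z x) ∧
      (∀ z ∈ S, ∀ x j, u z x j = f z x j + kerOp k q z (u z) x j) ∧
      (∀ x j, ContinuousOn (fun z => u z x j) S) ∧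
      ∀ x j, DifferentiableOn ℂ (fun z => u z x j) U := by
  set w : ℕ → ℂ → ℝ → Fin n → ℂ := fun N z => (kerOp k q z)^[N] (f z) with hw
  have hws : ∀ N z, w (N + 1) z = kerOp k q z (w N z) :=
    fun N z => Function.iterate_succ_apply' _ _ _
  have hw0 : ∀ z, w 0 z = f z := fun z => rfl
  have hwm : ∀ N, ∀ z ∈ S, ∀ j, Measurable fun x => w N z x j := by
    intro N
    induction N with
    | zero => exact hfm
    | succ N ih =>
      intro z hz j
      rw [hws]
      exact measurable_kerOp (hkm z hz) (ih z hz) j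
  -- The operator is only known to halve the norm in two steps. The ratio `3/4` suffices because
  -- `(3/4)² ≥ 1/2`, and `K` is large enough for both starting bounds, `A₀ ≤ K` and `A₀ B ≤ 3K/4`.
  set K : ℝ := 2 * A₀ * (1 + B) with hK
  have hK0 : 0 ≤ K := by positivity
  set c : ℕ → ℝ := fun N => K * (3 / 4 : ℝ) ^ N with hc
  have hc0 : ∀ N, 0 ≤ c N := fun N => by positivity
  have hcsum : HasSum c (8 * A₀ * (1 + B)) := by
    have := (hasSum_geometric_of_lt_one (r := (3 / 4 : ℝ)) (by norm_num) (by norm_num)).mul_left K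
    have e : 8 * A₀ * (1 + B) = K * (1 - 3 / 4 : ℝ)⁻¹ := by
      rw [hK]
      ring
    rw [e]
    exact this
  -- The induction carries two consecutive iterates, since the halving applies to the square of the
  -- operator.
  have hwb : ∀ z ∈ S, ∀ N, (∀ x j, ‖w N z x j‖ ≤ c N * W z x) ∧
      ∀ x j, ‖w (N + 1) z x j‖ ≤ c (N + 1) * W z x := by
    intro z hz N
    induction N with
    | zero =>
      refine ⟨fun x j => (hfb z hz x j).trans ?_, fun x j => ?_⟩
      · refine mul_le_mul_of_nonneg_right ?_ (hW z x)
        simp only [hc, hK, pow_zero, mul_one]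
        nlinarith [mul_nonneg hA₀ hB0]
      · rw [hws]
        refine ((hB z hz _ (hfm z hz) A₀ hA₀ (hfb z hz)).1 x j).trans ?_
        refine mul_le_mul_of_nonneg_right ?_ (hW z x)
        simp only [hc, hK, zero_add, pow_one]
        nlinarith [mul_nonneg hA₀ hB0]
    | succ N ih =>
      refine ⟨ih.2, fun x j => ?_⟩
      rw [hws, hws]
      refine ((hB z hz _ (hwm N z hz) (c N) (hc0 N) ih.1).2 x j).trans ?_
      refine mul_le_mul_of_nonneg_right ?_ (hW z x)
      simp only [hc, pow_succ]
      nlinarith [mul_nonneg hK0 (pow_nonneg (by norm_num : (0 : ℝ) ≤ 3 / 4) N)]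
  have hwS : ∀ N x j, ContinuousOn (fun z => w N z x j) S := by
    intro N
    induction N with
    | zero => exact hfS
    | succ N ih =>
      intro x j z₀ hz₀
      simp only [hws, kerOp]
      refine tendsto_finsetSum _ fun l _ => ?_
      obtain ⟨M, hM⟩ := hloc x z₀ hz₀
      refine continuousWithinAt_pairing (M := c N * M) (h := fun z t => k j z x t * w N z t l)
        (q := fun z => q z j l) (hqS j l z₀ hz₀)
        (fun z hz => (((hkm z hz j).of_uncurry_left).mul (hwm N z hz l)).aestronglyMeasurable)
        (fun t => (hkS j x t z₀ hz₀).mul (ih t l z₀ hz₀)) ?_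
      filter_upwards [hM, self_mem_nhdsWithin] with z hz hzS t
      rw [norm_mul]
      calc ‖k j z x t‖ * ‖w N z t l‖ ≤ ‖k j z x t‖ * (c N * W z t) :=
            mul_le_mul_of_nonneg_left ((hwb z hzS N).1 t l) (norm_nonneg _)
        _ = c N * (‖k j z x t‖ * W z t) := by ring
        _ ≤ c N * M := mul_le_mul_of_nonneg_left (hz.2 t j) (hc0 N)
  have hwU : ∀ N x j, DifferentiableOn ℂ (fun z => w N z x j) U := by
    intro N
    induction N with
    | zero => exact hfU
    | succ N ih =>
      intro x j z₀ hz₀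
      simp only [hws, kerOp]
      refine DifferentiableWithinAt.fun_sum fun l _ => ?_
      obtain ⟨M, hM⟩ := hloc x z₀ (hUS hz₀)
      refine (differentiableAt_pairing (M := c N * M) (h := fun z t => k j z x t * w N z t l)
        (q := fun z => q z j l) hU hz₀ (hqU j l)
        (fun z hz => (((hkm z (hUS hz) j).of_uncurry_left).mul
          (hwm N z (hUS hz) l)).aestronglyMeasurable)
        (fun t => (hkU j x t).mul (ih t l)) ?_).differentiableWithinAt
      have hM' := hM.filter_mono (nhdsWithin_mono z₀ hUS)
      rw [hU.nhdsWithin_eq hz₀] at hM'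
      filter_upwards [hM', hU.mem_nhds hz₀] with z hz hzU t
      rw [norm_mul]
      calc ‖k j z x t‖ * ‖w N z t l‖ ≤ ‖k j z x t‖ * (c N * W z t) :=
            mul_le_mul_of_nonneg_left ((hwb z (hUS hzU) N).1 t l) (norm_nonneg _)
        _ = c N * (‖k j z x t‖ * W z t) := by ring
        _ ≤ c N * M := mul_le_mul_of_nonneg_left (hz.2 t j) (hc0 N)
  have hsum : ∀ z ∈ S, ∀ x j, Summable fun N => w N z x j := fun z hz x j =>
    Summable.of_norm_bounded (hcsum.summable.mul_right (W z x)) fun N => (hwb z hz N).1 x j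
  refine ⟨fun z x j => ∑' N, w N z x j, ?_, ?_, ?_, ?_, ?_⟩
  · intro z hz j
    refine measurable_of_tendsto_metrizable
      (f := fun N x => ∑ i ∈ Finset.range N, w i z x j) (fun N => ?_) ?_
    · exact Finset.measurable_fun_sum _ fun i _ => hwm i z hz j
    · exact tendsto_pi_nhds.2 fun x => (hsum z hz x j).hasSum.tendsto_sum_nat
  · intro z hz x j
    exact tsum_of_norm_bounded (hcsum.mul_right (W z x)) fun N => (hwb z hz N).1 x j
  · intro z hz x j
    change ∑' N, w N z x j = f z x j + kerOp k q z (fun x j => ∑' N, w N z x j) x j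
    rw [(hsum z hz x j).tsum_eq_zero_add, hw0]
    congr 1
    obtain ⟨M, hM⟩ := hloc x z hz
    have hMz := (hM.self_of_nhdsWithin hz).2
    have hM0 : 0 ≤ M := (mul_nonneg (norm_nonneg _) (hW z x)).trans (hMz x j)
    have hb : ∀ N t l, ‖k j z x t * w N z t l‖ ≤ c N * M := by
      intro N t l
      rw [norm_mul]
      calc ‖k j z x t‖ * ‖w N z t l‖ ≤ ‖k j z x t‖ * (c N * W z t) :=
            mul_le_mul_of_nonneg_left ((hwb z hz N).1 t l) (norm_nonneg _)
        _ = c N * (‖k j z x t‖ * W z t) := by ring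
        _ ≤ c N * M := mul_le_mul_of_nonneg_left (hMz t j) (hc0 N)
    -- Sum and integral are interchanged by absolute convergence; this turns the shifted series into
    -- the operator applied to the sum.
    have hint : ∀ l, HasSum (fun N => ∫ t, k j z x t * w N z t l * q z j l t ∂ν)
        (∫ t, k j z x t * (∑' N, w N z t l) * q z j l t ∂ν) := by
      intro l
      have h1 := hasSum_integral_of_summable_integral_norm (μ := ν)
        (F := fun N t => k j z x t * w N z t l * q z j l t)
        (fun N => integrable_mul_Lp
          (((hkm z hz j).of_uncurry_left).mul (hwm N z hz l)).aestronglyMeasurable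
          (fun t => hb N t l) _) ?_
      · simpa only [tsum_mul_left, tsum_mul_right] using h1
      · refine Summable.of_nonneg_of_le (fun N => integral_nonneg fun t => norm_nonneg _)
          (fun N => ?_) (hcsum.summable.mul_right (M * ‖q z j l‖))
        rw [L1.norm_eq_integral_norm, ← mul_assoc, ← integral_const_mul]
        refine integral_mono_of_nonneg (Eventually.of_forall fun t => norm_nonneg _)
          ((L1.integrable_coeFn _).norm.const_mul _) (Eventually.of_forall fun t => ?_)
        simp only
        rw [norm_mul]
        exact mul_le_mul_of_nonneg_right (hb N t l) (norm_nonneg _)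
    have h2 := hasSum_sum (s := Finset.univ) fun l _ => hint l
    simp only [hws]
    exact h2.tsum_eq
  · intro x j z₀ hz₀
    obtain ⟨M, hM⟩ := hloc x z₀ hz₀
    obtain ⟨V, hV, hVM⟩ := mem_nhdsWithin_iff_exists_mem_nhds_inter.1 hM
    -- The weight is bounded near `z₀`, so the series converges uniformly there; the same bound
    -- gives holomorphy below.
    have h1 : ContinuousOn (fun z => ∑' N, w N z x j) (V ∩ S) := by
      refine continuousOn_tsum (fun N => (hwS N x j).mono inter_subset_right)
        (hcsum.summable.mul_right M) fun N z hz => ?_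
      exact ((hwb z hz.2 N).1 x j).trans (mul_le_mul_of_nonneg_left (hVM hz).1 (hc0 N))
    exact (h1 z₀ ⟨mem_of_mem_nhds hV, hz₀⟩).mono_of_mem_nhdsWithin
      (inter_mem (mem_nhdsWithin_of_mem_nhds hV) self_mem_nhdsWithin)
  · intro x j z₀ hz₀
    obtain ⟨M, hM⟩ := hloc x z₀ (hUS hz₀)
    have hM' := hM.filter_mono (nhdsWithin_mono z₀ hUS)
    rw [hU.nhdsWithin_eq hz₀] at hM'
    obtain ⟨V, hVM, hV, hzV⟩ := eventually_nhds_iff.1 hM'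
    have h1 : DifferentiableOn ℂ (fun z => ∑' N, w N z x j) (V ∩ U) := by
      refine Complex.differentiableOn_tsum_of_summable_norm (hcsum.summable.mul_right M)
        (fun N => (hwU N x j).mono inter_subset_right) (hV.inter hU) fun N z hz => ?_
      exact ((hwb z (hUS hz.2) N).1 x j).trans
        (mul_le_mul_of_nonneg_left (hVM z hz.1).1 (hc0 N))
    exact (h1.differentiableAt ((hV.inter hU).mem_nhds ⟨hzV, hz₀⟩)).differentiableWithinAt

end Picard

/-! ### The system on the whole line, its exponents and kernels -/

theorem HasAEDeriv.primitive_of_forall {f : ℝ → ℂ}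
    (hf : ∀ a b, IntervalIntegrable f volume a b) (c a b : ℝ) (κ : ℂ) :
    HasAEDeriv (fun x => κ + ∫ t in c..x, f t) f a b := by
  refine (HasAEDeriv.primitive (hf (min c (min a b)) (max c (max a b))) c ?_ κ).mono ?_
  · rw [uIcc_of_le (by simp)]
    simp
  · rw [uIcc_of_le (a := min c (min a b)) (by simp)]
    exact Icc_subset_Icc (by simp) (by simp)

theorem integral_ite_halfLine {s : Set ℝ} [DecidablePred (· ∈ s)] (hs : MeasurableSet s)
    (h0 : s ⊆ Ici 0) (F : ℝ → ℂ) :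
    ∫ t, (if t ∈ s then F t else 0) ∂(volume.restrict (Ici (0 : ℝ))) = ∫ t in s, F t := by
  have : (fun t => if t ∈ s then F t else 0) = s.indicator F := by
    ext t
    simp [indicator_apply]
  rw [this, integral_indicator hs, Measure.restrict_restrict hs, inter_eq_self_of_subset_left h0]

/-- The data of the differential system, extended to the whole line. -/
structure System (n : ℕ) where
  ρ : ℝ → ℝ
  b : Fin n → ℂ
  A : ℝ → Matrix (Fin n) (Fin n) ℂ
  C : ℂ → Matrix (Fin n) (Fin n) L1HalfLine
  locInt : LocallyIntegrable ρ
  pos : ∀ᵐ x ∂(volume.restrict (Ici (0 : ℝ))), 0 < ρ x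
  norm_b : ∀ j, ‖b j‖ ≤ 1
  intA : ∀ j l, Integrable (fun x => A x j l)
  diffC : ∀ j l, DifferentiableOn ℂ (fun z => C z j l) {0}ᶜ

namespace System

variable {n : ℕ} (S : System n)

/-- The function `p`. -/
noncomputable def p (x : ℝ) : ℝ := primitive S.ρ x

/-- The exponent in the solutions of the diagonal part of the system. -/
noncomputable def θ (j : Fin n) (z : ℂ) (x : ℝ) : ℂ :=
  z * S.b j * (S.p x : ℂ) + ∫ t in (0 : ℝ)..x, S.A t j j

/-- The part of the coefficients that is not absorbed into the exponents. -/
noncomputable def Q (z : ℂ) (j l : Fin n) : L1HalfLine :=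
  (if j = l then 0 else (S.intA j l).integrableOn.toL1) + S.C z j l

/-- A bound for the exponentials of the integrals of the diagonal entries. -/
noncomputable def D : ℝ := Real.exp (∑ j, ∫ t, ‖S.A t j j‖)

theorem D_pos : 0 < S.D := Real.exp_pos _

theorem intervalIntegrable_ρ (a b : ℝ) : IntervalIntegrable S.ρ volume a b :=
  (S.locInt.integrableOn_isCompact isCompact_uIcc).intervalIntegrable

theorem intervalIntegrable_A (j l : Fin n) (a b : ℝ) :
    IntervalIntegrable (fun t => S.A t j l) volume a b :=
  (S.intA j l).intervalIntegrable

theorem continuous_p : Continuous S.p :=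
  intervalIntegral.continuous_primitive S.intervalIntegrable_ρ 0

theorem p_sub_p (x t : ℝ) : S.p x - S.p t = ∫ s in t..x, S.ρ s :=
  intervalIntegral.integral_interval_sub_left (S.intervalIntegrable_ρ _ _)
    (S.intervalIntegrable_ρ _ _)

theorem p_mono {x t : ℝ} (hx : 0 ≤ x) (hxt : x ≤ t) : S.p x ≤ S.p t := by
  rw [← sub_nonneg, p_sub_p, intervalIntegral.integral_of_le hxt]
  refine setIntegral_nonneg_of_ae_restrict ?_
  have h := ae_restrict_of_ae_restrict_of_subset
    (Ioc_subset_Icc_self.trans (Icc_subset_Ici_self.trans (Ici_subset_Ici.2 hx)) : Ioc x t ⊆ Ici 0)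
    S.pos
  filter_upwards [h] with s hs using hs.le

theorem continuous_θ (j : Fin n) (z : ℂ) : Continuous (S.θ j z) :=
  (continuous_const.mul (Complex.continuous_ofReal.comp S.continuous_p)).add
    (intervalIntegral.continuous_primitive (S.intervalIntegrable_A j j) 0)

theorem differentiable_θ (j : Fin n) (x : ℝ) : Differentiable ℂ fun z => S.θ j z x := by
  unfold θ
  fun_prop

theorem hasAEDeriv_θ (j : Fin n) (z : ℂ) (a b : ℝ) :
    HasAEDeriv (S.θ j z) (fun t => z * S.b j * (S.ρ t : ℂ) + S.A t j j) a b := by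
  have hρ : ∀ a b, IntervalIntegrable (fun t => z * S.b j * (S.ρ t : ℂ)) volume a b :=
    fun a b => IntervalIntegrable.const_mul
      ⟨(S.intervalIntegrable_ρ a b).1.ofReal, (S.intervalIntegrable_ρ a b).2.ofReal⟩ _
  have h := HasAEDeriv.primitive_of_forall
    (fun a b => (hρ a b).add (S.intervalIntegrable_A j j a b)) 0 a b 0
  have e : (fun x => 0 + ∫ t in (0 : ℝ)..x, (z * S.b j * (S.ρ t : ℂ) + S.A t j j)) = S.θ j z := by
    ext x
    rw [zero_add, intervalIntegral.integral_add (hρ _ _) (S.intervalIntegrable_A j j _ _),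
      intervalIntegral.integral_const_mul, intervalIntegral.integral_ofReal]
    rfl
  exact e ▸ h

/-- The diagonal of `A` contributes an integral bounded by its total `L¹` norm, uniformly in the
interval and in `z`; keeping it in the exponent costs only the constant `D`. -/
theorem norm_exp_θ_sub_le (j : Fin n) (z : ℂ) (x t : ℝ) :
    ‖Complex.exp (S.θ j z x - S.θ j z t)‖ ≤
      S.D * Real.exp ((z * S.b j).re * (S.p x - S.p t)) := by
  have h1 : S.θ j z x - S.θ j z t =
      z * S.b j * ((S.p x - S.p t : ℝ) : ℂ) + ∫ s in t..x, S.A s j j := by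
    rw [← intervalIntegral.integral_interval_sub_left (S.intervalIntegrable_A j j 0 x)
      (S.intervalIntegrable_A j j 0 t)]
    simp only [θ]
    push_cast
    ring
  rw [h1, Complex.exp_add, norm_mul, mul_comm]
  refine mul_le_mul ?_ ?_ (norm_nonneg _) S.D_pos.le
  · rw [Complex.norm_exp]
    refine Real.exp_le_exp.2 ((Complex.re_le_norm _).trans ?_)
    refine intervalIntegral.norm_integral_le_integral_norm_uIoc.trans ?_
    refine (setIntegral_le_integral (S.intA j j).norm
      (Eventually.of_forall fun _ => norm_nonneg _)).trans ?_
    exact Finset.single_le_sum (f := fun j => ∫ t, ‖S.A t j j‖)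
      (fun i _ => integral_nonneg fun _ => norm_nonneg _) (Finset.mem_univ j)
  · rw [Complex.norm_exp, Complex.re_mul_ofReal]

theorem Q_ae (z : ℂ) (j l : Fin n) : ∀ᵐ x ∂(volume.restrict (Ici (0 : ℝ))),
    S.Q z j l x = (if j = l then 0 else S.A x j l) + S.C z j l x := by
  unfold Q
  filter_upwards [Lp.coeFn_add (if j = l then 0 else (S.intA j l).integrableOn.toL1) (S.C z j l),
    Lp.coeFn_zero ℂ 1 (volume.restrict (Ici (0 : ℝ))),
    (S.intA j l).integrableOn.coeFn_toL1] with x h1 h2 h3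
  rw [h1, Pi.add_apply]
  congr 1
  split_ifs with h
  · exact h2
  · exact h3

theorem differentiableOn_Q (j l : Fin n) : DifferentiableOn ℂ (fun z => S.Q z j l) {0}ᶜ :=
  (S.diffC j l).const_add _

theorem integrableOn_Q (z : ℂ) (j l : Fin n) : IntegrableOn (S.Q z j l) (Ici 0) :=
  L1.integrable_coeFn _

theorem integrableOn_mul_Q {s : Set ℝ} (hs : MeasurableSet s) (h0 : s ⊆ Ici 0) {h : ℝ → ℂ}
    (hm : Measurable h) {M : ℝ} (hM : ∀ t ∈ s, ‖h t‖ ≤ M) (z : ℂ) (j l : Fin n) :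
    IntegrableOn (fun t => h t * S.Q z j l t) s :=
  ((S.integrableOn_Q z j l).mono_set h0).bdd_mul hm.aestronglyMeasurable
    ((ae_restrict_iff' hs).2 (Eventually.of_forall hM))

/-- The kernel of the integral equation on `[α, ∞)`: the components satisfying `P` are integrated
from `α`, the other ones from infinity. -/
noncomputable def fker (α : ℝ) (P : Fin n → Prop) [DecidablePred P] (j : Fin n) (z : ℂ)
    (x t : ℝ) : ℂ :=
  if P j then (if α < t ∧ t ≤ x then Complex.exp (S.θ j z x - S.θ j z t) else 0)
  else (if α ≤ x ∧ x < t then -Complex.exp (S.θ j z x - S.θ j z t) else 0)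

/-- The weight on `[α, ∞)`. -/
noncomputable def wt (α μ x : ℝ) : ℝ := if α ≤ x then Real.exp (μ * (S.p x - S.p α)) else 0

theorem wt_nonneg (α μ x : ℝ) : 0 ≤ S.wt α μ x := by
  unfold wt
  split_ifs
  · exact (Real.exp_pos _).le
  · exact le_rfl

theorem measurable_exp_θ_sub (j : Fin n) (z : ℂ) :
    Measurable fun y : ℝ × ℝ => Complex.exp (S.θ j z y.1 - S.θ j z y.2) :=
  (Complex.continuous_exp.comp (((S.continuous_θ j z).comp continuous_fst).sub
    ((S.continuous_θ j z).comp continuous_snd))).measurable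

/-! ### The integral operator on `[α, ∞)` in the weighted norm -/

section Forward

variable {α : ℝ} {P : Fin n → Prop} [DecidablePred P] {z : ℂ} {μ : ℝ}

theorem measurable_fker (j : Fin n) : Measurable (Function.uncurry (S.fker α P j z)) := by
  unfold fker Function.uncurry
  by_cases hj : P j
  · simp only [hj, if_true]
    refine Measurable.ite ?_ (S.measurable_exp_θ_sub j z) measurable_const
    exact (measurableSet_lt measurable_const measurable_snd).inter
      (measurableSet_le measurable_snd measurable_fst)
  · simp only [hj, if_false]
    refine Measurable.ite ?_ (S.measurable_exp_θ_sub j z).neg measurable_const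
    exact (measurableSet_le measurable_const measurable_fst).inter
      (measurableSet_lt measurable_fst measurable_snd)

/-- The combined exponent is `(Re(z b_j) - μ)(p(x) - p(t))` plus the exponent of the weight at `x`.
The first product is nonpositive in both cases, because the sign of `Re(z b_j) - μ` and the order of
`x` and `t` change together. -/
theorem norm_exp_mul_wt_le (hα : 0 ≤ α) (hP : ∀ j, P j → (z * S.b j).re ≤ μ)
    (hN : ∀ j, ¬ P j → μ ≤ (z * S.b j).re) (j : Fin n) {x t : ℝ} (hx : α ≤ x) (ht : α ≤ t)
    (h1 : P j → t ≤ x) (h2 : ¬ P j → x ≤ t) :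
    ‖Complex.exp (S.θ j z x - S.θ j z t)‖ * S.wt α μ t ≤ S.D * S.wt α μ x := by
  simp only [wt, hx, ht, if_true]
  refine (mul_le_mul_of_nonneg_right (S.norm_exp_θ_sub_le j z x t) (Real.exp_pos _).le).trans ?_
  rw [mul_assoc, ← Real.exp_add]
  refine mul_le_mul_of_nonneg_left (Real.exp_le_exp.2 ?_) S.D_pos.le
  by_cases hj : P j
  · nlinarith [hP j hj, S.p_mono (hα.trans ht) (h1 hj)]
  · nlinarith [hN j hj, S.p_mono (hα.trans hx) (h2 hj)]

theorem norm_fker_mul_wt_le (hα : 0 ≤ α) (hP : ∀ j, P j → (z * S.b j).re ≤ μ)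
    (hN : ∀ j, ¬ P j → μ ≤ (z * S.b j).re) (j : Fin n) (x t : ℝ) :
    ‖S.fker α P j z x t‖ * S.wt α μ t ≤ S.D * S.wt α μ x := by
  have h0 : 0 ≤ S.D * S.wt α μ x := mul_nonneg S.D_pos.le (S.wt_nonneg _ _ _)
  unfold fker
  by_cases hj : P j
  · simp only [hj, if_true]
    split_ifs with h
    · exact S.norm_exp_mul_wt_le hα hP hN j (h.1.le.trans h.2) h.1.le (fun _ => h.2)
        (fun h' => absurd hj h')
    · simpa using h0
  · simp only [hj, if_false]
    split_ifs with h
    · rw [norm_neg]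
      exact S.norm_exp_mul_wt_le hα hP hN j h.1 (h.1.trans h.2.le) (fun h' => absurd h' hj)
        (fun _ => h.2.le)
    · simpa using h0

theorem fker_eq_zero {j : Fin n} {x t : ℝ} (ht : t < α) : S.fker α P j z x t = 0 := by
  unfold fker
  split_ifs with h1 h2 h2
  · linarith [h2.1]
  · rfl
  · linarith [h2.1, h2.2]
  · rfl

theorem fker_mul_le (hα : 0 ≤ α) (hP : ∀ j, P j → (z * S.b j).re ≤ μ)
    (hN : ∀ j, ¬ P j → μ ≤ (z * S.b j).re) {w : ℝ → ℂ} {a : ℝ} (ha : 0 ≤ a)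
    (hw : ∀ x, ‖w x‖ ≤ a * S.wt α μ x) (j : Fin n) (x t : ℝ) :
    ‖S.fker α P j z x t * w t‖ ≤ a * (S.D * S.wt α μ x) := by
  rw [norm_mul]
  calc _ ≤ ‖S.fker α P j z x t‖ * (a * S.wt α μ t) :=
        mul_le_mul_of_nonneg_left (hw t) (norm_nonneg _)
    _ = a * (‖S.fker α P j z x t‖ * S.wt α μ t) := by ring
    _ ≤ _ := mul_le_mul_of_nonneg_left (S.norm_fker_mul_wt_le hα hP hN j x t) ha

/-- The kernel vanishes for `t < α`, so only the tail of `f` enters the bound. This is what makes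
the operator small for large `α`. -/
theorem norm_integral_fker_le (hα : 0 ≤ α) (hP : ∀ j, P j → (z * S.b j).re ≤ μ)
    (hN : ∀ j, ¬ P j → μ ≤ (z * S.b j).re) {w : ℝ → ℂ} {a : ℝ} (ha : 0 ≤ a)
    (hw : ∀ x, ‖w x‖ ≤ a * S.wt α μ x) {f : ℝ → ℂ} (hf : IntegrableOn f (Ici 0)) (j : Fin n)
    (x : ℝ) :
    ‖∫ t, S.fker α P j z x t * w t * f t ∂(volume.restrict (Ici (0 : ℝ)))‖ ≤
      a * S.D * S.wt α μ x * ∫ t in Ici α, ‖f t‖ := by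
  have h1 : ∫ t, S.fker α P j z x t * w t * f t ∂(volume.restrict (Ici (0 : ℝ))) =
      ∫ t in Ici α, S.fker α P j z x t * w t * f t := by
    refine setIntegral_eq_of_subset_of_forall_sdiff_eq_zero measurableSet_Ici
      (Ici_subset_Ici.2 hα) fun t ht => ?_
    rw [S.fker_eq_zero (not_le.1 ht.2), zero_mul, zero_mul]
  rw [h1, ← integral_const_mul]
  refine norm_integral_le_of_norm_le ((hf.mono_set (Ici_subset_Ici.2 hα)).norm.const_mul _)
    (Eventually.of_forall fun t => ?_)
  rw [norm_mul]
  refine mul_le_mul_of_nonneg_right ((S.fker_mul_le hα hP hN ha hw j x t).trans_eq ?_)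
    (norm_nonneg _)
  ring

theorem norm_kerOp_fker_le (hα : 0 ≤ α) (hP : ∀ j, P j → (z * S.b j).re ≤ μ)
    (hN : ∀ j, ¬ P j → μ ≤ (z * S.b j).re) {w : ℝ → Fin n → ℂ} {a : ℝ} (ha : 0 ≤ a)
    (hw : ∀ x j, ‖w x j‖ ≤ a * S.wt α μ x) {β : ℝ} {j : Fin n}
    (hβ : ∑ l, ∫ t in Ici α, ‖S.Q z j l t‖ ≤ β) (x : ℝ) :
    ‖kerOp (S.fker α P) S.Q z w x j‖ ≤ a * (S.D * β) * S.wt α μ x := by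
  unfold kerOp
  refine (norm_sum_le _ _).trans ((Finset.sum_le_sum fun l _ =>
    S.norm_integral_fker_le hα hP hN ha (fun x => hw x l) (S.integrableOn_Q z j l) j x).trans ?_)
  rw [← Finset.mul_sum]
  refine (mul_le_mul_of_nonneg_left hβ (mul_nonneg (mul_nonneg ha S.D_pos.le)
    (S.wt_nonneg _ _ _))).trans_eq ?_
  ring

/-- The right-hand side of the equations in the variation of constants. -/
noncomputable def src (z : ℂ) (w : ℝ → Fin n → ℂ) (j : Fin n) (t : ℝ) : ℂ :=
  Complex.exp (-S.θ j z t) * ∑ l, w t l * S.Q z j l t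

theorem exp_mul_src (w : ℝ → Fin n → ℂ) (j : Fin n) (x t : ℝ) :
    Complex.exp (S.θ j z x) * S.src z w j t =
      ∑ l, Complex.exp (S.θ j z x - S.θ j z t) * w t l * S.Q z j l t := by
  unfold src
  rw [← mul_assoc, ← Complex.exp_add, Finset.mul_sum, sub_eq_add_neg]
  simp only [mul_assoc]

/-- Multiplication by the nonzero constant `exp(θ_j(x₀))` reduces integrability to a bound on an
exponential of a difference; `x₀` is the point at which such a bound is available. -/
theorem integrableOn_src {s : Set ℝ} (hs : MeasurableSet s) (h0 : s ⊆ Ici 0)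
    {w : ℝ → Fin n → ℂ} (hwm : ∀ j, Measurable fun x => w x j) {M : ℝ} (j : Fin n) {x₀ : ℝ}
    (hM : ∀ t ∈ s, ∀ l, ‖Complex.exp (S.θ j z x₀ - S.θ j z t) * w t l‖ ≤ M) :
    IntegrableOn (S.src z w j) s := by
  have h1 : IntegrableOn (fun t => Complex.exp (S.θ j z x₀) * S.src z w j t) s := by
    simp only [exp_mul_src]
    refine integrable_finsetSum _ fun l _ => ?_
    refine S.integrableOn_mul_Q hs h0
      (((S.measurable_exp_θ_sub j z).comp measurable_prodMk_left).mul (hwm l))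
      (fun t ht => hM t ht l) z j l
  have h2 := h1.const_mul (Complex.exp (S.θ j z x₀))⁻¹
  simpa only [← mul_assoc, inv_mul_cancel₀ (Complex.exp_ne_zero _), one_mul, IntegrableOn] using h2

theorem integrableOn_Ioc_src (hα : 0 ≤ α) {w : ℝ → Fin n → ℂ}
    (hwm : ∀ j, Measurable fun x => w x j) {a : ℝ}
    (hw : ∀ x j, ‖w x j‖ ≤ a * S.wt α μ x) (j : Fin n) (x : ℝ) :
    IntegrableOn (S.src z w j) (Ioc α x) := by
  have hc : Continuous fun t => ‖Complex.exp (S.θ j z x - S.θ j z t)‖ *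
      (a * Real.exp (μ * (S.p t - S.p α))) :=
    ((continuous_const.sub (S.continuous_θ j z)).cexp.norm).mul (continuous_const.mul
      (Real.continuous_exp.comp (continuous_const.mul (S.continuous_p.sub continuous_const))))
  obtain ⟨M, hM⟩ := (isCompact_Icc (a := α) (b := x)).exists_bound_of_continuousOn hc.continuousOn
  refine S.integrableOn_src measurableSet_Ioc
    (Ioc_subset_Icc_self.trans (Icc_subset_Ici_self.trans (Ici_subset_Ici.2 hα))) hwm (x₀ := x)
    (M := M) j fun t ht l => ?_
  refine le_trans ?_ ((le_abs_self _).trans (hM t (Ioc_subset_Icc_self ht)))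
  rw [norm_mul]
  refine mul_le_mul_of_nonneg_left ((hw t l).trans_eq ?_) (norm_nonneg _)
  rw [wt, if_pos ht.1.le]

theorem integrableOn_Ioi_src (hα : 0 ≤ α) (hP : ∀ j, P j → (z * S.b j).re ≤ μ)
    (hN : ∀ j, ¬ P j → μ ≤ (z * S.b j).re) {w : ℝ → Fin n → ℂ}
    (hwm : ∀ j, Measurable fun x => w x j) {a : ℝ} (ha : 0 ≤ a)
    (hw : ∀ x j, ‖w x j‖ ≤ a * S.wt α μ x) {j : Fin n} (hj : ¬ P j) :
    IntegrableOn (S.src z w j) (Ioi α) := by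
  refine S.integrableOn_src measurableSet_Ioi
    (Ioi_subset_Ici_self.trans (Ici_subset_Ici.2 hα)) hwm (x₀ := α)
    (M := a * (S.D * S.wt α μ α)) j fun t ht l => ?_
  -- For a component integrated from infinity, the kernel at `x = α` is minus the exponential on all
  -- of `(α, ∞)`.
  refine le_trans (le_of_eq ?_) (S.fker_mul_le hα hP hN ha (fun x => hw x l) j α t)
  have : t ∈ Ioi α := ht
  simp [fker, hj, mem_Ioi.1 this]

/-- The operator of the integral equation in the form of the variation of constants. -/
theorem exists_kerOp_fker_eq (hα : 0 ≤ α) (hP : ∀ j, P j → (z * S.b j).re ≤ μ)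
    (hN : ∀ j, ¬ P j → μ ≤ (z * S.b j).re) {w : ℝ → Fin n → ℂ}
    (hwm : ∀ j, Measurable fun x => w x j) {a : ℝ} (ha : 0 ≤ a)
    (hw : ∀ x j, ‖w x j‖ ≤ a * S.wt α μ x) (j : Fin n) :
    ∃ κ : ℂ, (P j → κ = 0) ∧ ∀ x, α ≤ x → kerOp (S.fker α P) S.Q z w x j =
      Complex.exp (S.θ j z x) * (κ + ∫ t in α..x, S.src z w j t) := by
  have hint : ∀ x l, Integrable (fun t => S.fker α P j z x t * w t l * S.Q z j l t)
      (volume.restrict (Ici (0 : ℝ))) := fun x l =>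
    integrable_mul_Lp ((((S.measurable_fker j).of_uncurry_left).mul
      (hwm l)).aestronglyMeasurable) (fun t => S.fker_mul_le hα hP hN ha (fun x => hw x l) j x t) _
  have hsum : ∀ x, kerOp (S.fker α P) S.Q z w x j =
      ∫ t, ∑ l, S.fker α P j z x t * w t l * S.Q z j l t ∂(volume.restrict (Ici (0 : ℝ))) :=
    fun x => (integral_finsetSum _ fun l _ => hint x l).symm
  by_cases hj : P j
  · refine ⟨0, fun _ => rfl, fun x hx => ?_⟩
    have h1 : ∀ t, ∑ l, S.fker α P j z x t * w t l * S.Q z j l t =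
        if t ∈ Ioc α x then Complex.exp (S.θ j z x) * S.src z w j t else 0 := by
      intro t
      rw [exp_mul_src]
      by_cases ht : α < t ∧ t ≤ x
      · simp [fker, hj, ht]
      · rw [if_neg (c := t ∈ Ioc α x) ht]
        simp [fker, hj, ht]
    simp only [hsum, h1]
    rw [integral_ite_halfLine measurableSet_Ioc
      (Ioc_subset_Icc_self.trans (Icc_subset_Ici_self.trans (Ici_subset_Ici.2 hα))), zero_add,
      intervalIntegral.integral_of_le hx, integral_const_mul]
  -- The integral from infinity is rewritten by `-∫ₓ^∞ = -∫_α^∞ + ∫_αˣ`; the first term is the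
  -- constant.
  · refine ⟨-∫ t in Ioi α, S.src z w j t, fun h => absurd h hj, fun x hx => ?_⟩
    have h1 : ∀ t, ∑ l, S.fker α P j z x t * w t l * S.Q z j l t =
        if t ∈ Ioi x then -Complex.exp (S.θ j z x) * S.src z w j t else 0 := by
      intro t
      rw [neg_mul, exp_mul_src]
      by_cases ht : x < t
      · simp [fker, hj, ht, hx]
      · simp [fker, hj, ht]
    simp only [hsum, h1]
    have hI := S.integrableOn_Ioi_src hα hP hN hwm ha hw hj
    rw [integral_ite_halfLine measurableSet_Ioi
      (Ioi_subset_Ici_self.trans (Ici_subset_Ici.2 (hα.trans hx))), integral_const_mul,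
      ← intervalIntegral.integral_Ioi_sub_Ioi hI hx]
    ring

end Forward

end System

/-! ### Integration by parts in oscillating integrals -/

/-- Approximation of summable functions by smooth multiples of a positive density. -/
theorem exists_smooth_mul_approx {ρ : ℝ → ℝ} (hρ : LocallyIntegrable ρ)
    (hpos : ∀ᵐ x ∂(volume.restrict (Ici (0 : ℝ))), 0 < ρ x) {f : ℝ → ℂ} (hf : Integrable f)
    {δ : ℝ} (hδ : 0 < δ) :
    ∃ g : ℝ → ℂ, HasCompactSupport g ∧ ContDiff ℝ 1 g ∧
      IntegrableOn (fun x => f x - g x * (ρ x : ℂ)) (Ici 0) ∧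
      ∫ x in Ici (0 : ℝ), ‖f x - g x * (ρ x : ℂ)‖ ≤ δ := by
  set ν := volume.restrict (Ici (0 : ℝ)) with hν
  have hρm : AEStronglyMeasurable ρ ν := hρ.aestronglyMeasurable.restrict
  have hρe : AEMeasurable (fun x => (ρ x).toNNReal) ν := hρm.aemeasurable.real_toNNReal
  -- Smooth functions with compact support are dense in `L¹` of the measure `ρ dx`. Approximating `f
  -- / ρ` there amounts to approximating `f` by `g ρ` in `L¹(dx)`.
  set μ := ν.withDensity (fun x => ((ρ x).toNNReal : ENNReal)) with hμ
  have hcoe : ∀ᵐ x ∂ν, ((ρ x).toNNReal : ℝ) = ρ x := by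
    filter_upwards [hpos] with x hx using Real.coe_toNNReal _ hx.le
  have hint : ∀ h : ℝ → ℂ, Integrable h μ ↔ Integrable (fun x => h x * (ρ x : ℂ)) ν := by
    intro h
    rw [hμ, integrable_withDensity_iff_integrable_smul₀ hρe]
    refine integrable_congr ?_
    filter_upwards [hcoe] with x hx
    rw [NNReal.smul_def, hx, Complex.real_smul, mul_comm]
  have hfin : IsFiniteMeasureOnCompacts μ := by
    refine ⟨fun K hK => ?_⟩
    rw [hμ, withDensity_apply₀ _ (hK.measurableSet.nullMeasurableSet)]
    have h1 : IntegrableOn ρ K ν :=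
      (hρ.integrableOn_isCompact hK).mono_measure Measure.restrict_le_self
    refine lt_of_le_of_lt ?_ h1.2
    refine lintegral_mono fun x => ?_
    rw [Real.enorm_eq_ofReal_abs]
    exact ENNReal.ofReal_le_ofReal (le_abs_self _)
  have hquot : Integrable (fun x => f x * ((ρ x)⁻¹ : ℂ)) μ := by
    rw [hint]
    refine (hf.restrict (s := Ici 0)).congr ?_
    filter_upwards [hpos] with x hx
    rw [mul_assoc, inv_mul_cancel₀ (by exact_mod_cast hx.ne'), mul_one]
  obtain ⟨g, hg1, hg2, hg3⟩ := (memLp_one_iff_integrable.2 hquot).exist_eLpNorm_sub_le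
    (by simp) le_rfl hδ
  have hgi : Integrable g μ := hg2.continuous.integrable_of_hasCompactSupport hg1
  have hsub : Integrable (fun x => (f x * ((ρ x)⁻¹ : ℂ) - g x)) μ := hquot.sub hgi
  have heq : ∀ᵐ x ∂ν, (f x * ((ρ x)⁻¹ : ℂ) - g x) * (ρ x : ℂ) = f x - g x * (ρ x : ℂ) := by
    filter_upwards [hpos] with x hx
    rw [sub_mul, mul_assoc, inv_mul_cancel₀ (by exact_mod_cast hx.ne'), mul_one]
  refine ⟨g, hg1, hg2.of_le (by exact_mod_cast le_top), ((hint _).1 hsub).congr heq, ?_⟩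
  have h1 : ∫ x, ‖f x * ((ρ x)⁻¹ : ℂ) - g x‖ ∂μ ≤ δ := by
    rw [eLpNorm_one_eq_lintegral_enorm] at hg3
    rw [integral_norm_eq_lintegral_enorm hsub.aestronglyMeasurable]
    exact ENNReal.toReal_le_of_le_ofReal hδ.le hg3
  refine le_trans (le_of_eq ?_) h1
  rw [hμ, integral_withDensity_eq_integral_smul₀ hρe]
  refine integral_congr_ae ?_
  filter_upwards [heq, hcoe, hpos] with x h1 h2 h3
  rw [← h1, NNReal.smul_def, h2, norm_mul, Complex.norm_real, Real.norm_of_nonneg h3.le,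
    smul_eq_mul, mul_comm]

namespace System

variable {n : ℕ} (S : System n) {α : ℝ} {P : Fin n → Prop} [DecidablePred P] {z : ℂ} {μ : ℝ}

/-- The constant in the oscillation estimate. -/
noncomputable def oscConst (B β G G' : ℝ) (j l : Fin n) : ℝ :=
  2 * B * G + B * G * ((∫ t, ‖S.A t l l‖) + ∫ t, ‖S.A t j j‖) + G * β + B * G'

/-- Integration by parts for an oscillating integral. -/
theorem norm_mul_integral_le (hα : 0 ≤ α) {w v : ℝ → Fin n → ℂ}
    (hwm : ∀ j, Measurable fun x => w x j) {a B β G : ℝ} (ha : 0 ≤ a) (hB : 0 ≤ B)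
    (hw : ∀ x j, ‖w x j‖ ≤ a * S.wt α μ x) (hv : ∀ x j, ‖v x j‖ ≤ a * B * S.wt α μ x)
    {l : Fin n} {κ : ℂ} (hκ : ∀ x, α ≤ x → v x l =
      Complex.exp (S.θ l z x) * (κ + ∫ t in α..x, S.src z w l t))
    (hβ : ∑ r, ∫ t in Ici α, ‖S.Q z l r t‖ ≤ β)
    {g : ℝ → ℂ} (hg : HasCompactSupport g) (hg' : ContDiff ℝ 1 g) (hG : ∀ t, ‖g t‖ ≤ G)
    {j : Fin n} {x M c d : ℝ} (hc : α ≤ c) (hcd : c ≤ d)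
    (hM : ∀ t ∈ Icc c d, ‖Complex.exp (S.θ j z x - S.θ j z t)‖ * S.wt α μ t ≤ M) :
    ‖z‖ * ‖S.b l - S.b j‖ *
      ‖∫ t in c..d, Complex.exp (S.θ j z x - S.θ j z t) * v t l * (g t * (S.ρ t : ℂ))‖ ≤
      a * M * S.oscConst B β G (∫ t, ‖deriv g t‖) j l := by
  have hG0 : 0 ≤ G := (norm_nonneg _).trans (hG 0)
  have hM0 : 0 ≤ M := (mul_nonneg (norm_nonneg _) (S.wt_nonneg _ _ _)).trans
    (hM c (left_mem_Icc.2 hcd))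
  have hu : uIcc c d = Icc c d := uIcc_of_le hcd
  have hsub : Icc c d ⊆ Icc α d := Icc_subset_Icc_left hc
  -- the functions entering the product
  have hsrc : IntervalIntegrable (S.src z w l) volume α d := by
    rw [intervalIntegrable_iff_integrableOn_Ioc_of_le (hc.trans hcd)]
    exact S.integrableOn_Ioc_src hα hwm hw l d
  -- The function `v` is an image under the operator. After division by `exp(θ_l)` it has the
  -- derivative `src`, free of the factor `z ρ`; this is why the square of the operator is estimated
  -- and not the operator itself.
  set V : ℝ → ℂ := fun t => κ + ∫ s in α..t, S.src z w l s with hV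
  have hVd : HasAEDeriv V (S.src z w l) c d :=
    (HasAEDeriv.primitive hsrc α (by simp) κ).mono (by
      rw [hu, uIcc_of_le (hc.trans hcd)]
      exact hsub)
  set E : ℝ → ℂ := fun t => Complex.exp (S.θ j z x + (S.θ l z t - S.θ j z t)) with hE
  set e' : ℝ → ℂ := fun t => (z * S.b l * (S.ρ t : ℂ) + S.A t l l) -
    (z * S.b j * (S.ρ t : ℂ) + S.A t j j) with he'
  have hEd : HasAEDeriv E (fun t => E t * e' t) c d := by
    have h1 := S.hasAEDeriv_θ l z c d
    have h2 := S.hasAEDeriv_θ j z c d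
    have h3 : HasAEDeriv (fun t => S.θ j z x + (S.θ l z t - S.θ j z t)) e' c d := by
      refine ⟨?_, h1.int.sub h2.int, ?_⟩
      · refine absolutelyContinuousOnInterval_of_dist_le (h1.ac.sub h2.ac) 1 ?_
        intro s _ t _
        rw [dist_add_left, one_mul]
        rfl
      · filter_upwards [h1.deriv, h2.deriv] with t h1 h2 ht
        exact ((h1 ht).fun_sub (h2 ht)).const_add _
    exact h3.cexp
  have hgd : HasAEDeriv g (deriv g) c d :=
    ⟨hg'.contDiffOn.absolutelyContinuousOnInterval,
      (hg'.continuous_deriv le_rfl).intervalIntegrable _ _,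
      Eventually.of_forall fun t _ => (hg'.differentiable one_ne_zero t).hasDerivAt⟩
  set H : ℝ → ℂ := fun t => Complex.exp (S.θ j z x - S.θ j z t) * v t l with hH
  have hHE : ∀ t, α ≤ t → H t = E t * V t := by
    intro t ht
    simp only [hH, hE, hV]
    rw [hκ t ht, ← mul_assoc, ← Complex.exp_add]
    ring_nf
  have hHb : ∀ t ∈ Icc c d, ‖H t‖ ≤ a * B * M := by
    intro t ht
    simp only [hH]
    rw [norm_mul]
    calc _ ≤ ‖Complex.exp (S.θ j z x - S.θ j z t)‖ * (a * B * S.wt α μ t) :=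
          mul_le_mul_of_nonneg_left (hv t l) (norm_nonneg _)
      _ = a * B * (‖Complex.exp (S.θ j z x - S.θ j z t)‖ * S.wt α μ t) := by ring
      _ ≤ _ := mul_le_mul_of_nonneg_left (hM t ht) (mul_nonneg ha hB)
  -- the derivative of the product
  have hprod := (hEd.mul hVd).mul hgd
  set F' : ℝ → ℂ := fun t => (E t * e' t * V t + E t * S.src z w l t) * g t +
    E t * V t * deriv g t with hF'
  have hF'int : IntervalIntegrable F' volume c d := hprod.int
  have hFTC : ∫ t in c..d, F' t = E d * V d * g d - E c * V c * g c := hprod.integral_eq_sub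
  -- `L` is the part of `(E V g)'` with the explicit factor `z (b_l - b_j) ρ`; the rest is bounded
  -- by `Rt`, whose integral is controlled independently of `z`.
  set L : ℝ → ℂ := fun t => z * (S.b l - S.b j) * (E t * V t * (g t * (S.ρ t : ℂ))) with hL
  have hLint : IntervalIntegrable L volume c d := by
    have h1 : IntervalIntegrable (fun t => (S.ρ t : ℂ)) volume c d :=
      ⟨(S.intervalIntegrable_ρ c d).1.ofReal, (S.intervalIntegrable_ρ c d).2.ofReal⟩
    have h2 := (h1.continuousOn_mul hg'.continuous.continuousOn).continuousOn_mul
      (hEd.ac.continuousOn.mul hVd.ac.continuousOn)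
    exact h2.const_mul _
  set Rt : ℝ → ℝ := fun t => a * M * (B * G * (‖S.A t l l‖ + ‖S.A t j j‖) +
    G * (∑ r, ‖S.Q z l r t‖) + B * ‖deriv g t‖) with hRt
  have hQint : ∀ r, IntegrableOn (fun t => ‖S.Q z l r t‖) (Ici α) := fun r =>
    ((S.integrableOn_Q z l r).mono_set (Ici_subset_Ici.2 hα)).norm
  have hIoc : Ioc c d ⊆ Ici α := fun t ht => hc.trans ht.1.le
  have hQi : IntegrableOn (fun t => ∑ r, ‖S.Q z l r t‖) (Ici α) :=
    integrable_finsetSum _ fun r _ => hQint r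
  have hdg : Integrable (fun t => ‖deriv g t‖) :=
    ((hg'.continuous_deriv le_rfl).integrable_of_hasCompactSupport hg.deriv).norm
  have hRtI : IntegrableOn Rt (Ioc c d) :=
    ((((((S.intA l l).norm.add (S.intA j j).norm).const_mul (B * G)).integrableOn).add
      ((hQi.mono_set hIoc).const_mul G)).add (hdg.const_mul B).integrableOn).const_mul (a * M)
  have hRt_le : ∫ t in c..d, Rt t ≤ a * M * (B * G * ((∫ t, ‖S.A t l l‖) + ∫ t, ‖S.A t j j‖) +
      G * β + B * ∫ t, ‖deriv g t‖) := by
    rw [intervalIntegral.integral_of_le hcd, hRt, integral_const_mul]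
    refine mul_le_mul_of_nonneg_left ?_ (mul_nonneg ha hM0)
    have i1 : IntegrableOn (fun t => B * G * (‖S.A t l l‖ + ‖S.A t j j‖)) (Ioc c d) :=
      (((S.intA l l).norm.add (S.intA j j).norm).const_mul (B * G)).integrableOn
    have i2 : IntegrableOn (fun t => G * (∑ r, ‖S.Q z l r t‖)) (Ioc c d) :=
      (hQi.mono_set hIoc).const_mul G
    have i3 : IntegrableOn (fun t => B * ‖deriv g t‖) (Ioc c d) :=
      (hdg.const_mul B).integrableOn
    have i12 : IntegrableOn (fun t => B * G * (‖S.A t l l‖ + ‖S.A t j j‖) +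
      G * (∑ r, ‖S.Q z l r t‖)) (Ioc c d) := i1.add i2
    rw [integral_add i12 i3, integral_add i1 i2, integral_const_mul,
      integral_const_mul, integral_const_mul,
      integral_add (S.intA l l).norm.integrableOn (S.intA j j).norm.integrableOn]
    have s1 := fun r : Fin n => setIntegral_le_integral (s := Ioc c d) (S.intA r r).norm
      (Eventually.of_forall fun _ => norm_nonneg _)
    have s2 : ∫ t in Ioc c d, ∑ r, ‖S.Q z l r t‖ ≤ β := by
      refine le_trans ?_ hβ
      rw [← integral_finsetSum _ fun r _ => hQint r]
      exact setIntegral_mono_set hQi (Eventually.of_forall fun t =>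
        Finset.sum_nonneg fun _ _ => norm_nonneg _) hIoc.eventuallyLE
    have s3 := setIntegral_le_integral (s := Ioc c d) hdg
      (Eventually.of_forall fun _ => norm_nonneg _)
    exact add_le_add (add_le_add (mul_le_mul_of_nonneg_left (add_le_add (s1 l) (s1 j))
      (mul_nonneg hB hG0)) (mul_le_mul_of_nonneg_left s2 hG0)) (mul_le_mul_of_nonneg_left s3 hB)
  have hrest : ‖∫ t in c..d, (F' t - L t)‖ ≤ ∫ t in c..d, Rt t := by
    refine intervalIntegral.norm_integral_le_of_norm_le hcd ?_
      ((intervalIntegrable_iff_integrableOn_Ioc_of_le hcd).2 hRtI)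
    refine Eventually.of_forall fun t ht => ?_
    have htI : t ∈ Icc c d := Ioc_subset_Icc_self ht
    have hαt : α ≤ t := hc.trans htI.1
    have k1 : F' t - L t = H t * g t * (S.A t l l - S.A t j j) +
        E t * S.src z w l t * g t + H t * deriv g t := by
      simp only [hF', hL, he', hHE t hαt]
      ring
    have k2 : E t * S.src z w l t =
        ∑ r, Complex.exp (S.θ j z x - S.θ j z t) * w t r * S.Q z l r t := by
      simp only [hE, src, Finset.mul_sum]
      refine Finset.sum_congr rfl fun r _ => ?_
      rw [← mul_assoc, ← Complex.exp_add, ← mul_assoc]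
      ring_nf
    have k3 : ‖E t * S.src z w l t‖ ≤ a * M * ∑ r, ‖S.Q z l r t‖ := by
      rw [k2, Finset.mul_sum]
      refine norm_sum_le_of_le _ fun r _ => ?_
      rw [norm_mul]
      refine mul_le_mul_of_nonneg_right ?_ (norm_nonneg _)
      rw [norm_mul]
      calc _ ≤ ‖Complex.exp (S.θ j z x - S.θ j z t)‖ * (a * S.wt α μ t) :=
            mul_le_mul_of_nonneg_left (hw t r) (norm_nonneg _)
        _ = a * (‖Complex.exp (S.θ j z x - S.θ j z t)‖ * S.wt α μ t) := by ring
        _ ≤ _ := mul_le_mul_of_nonneg_left (hM t htI) ha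
    have hQ0 : 0 ≤ ∑ r, ‖S.Q z l r t‖ := Finset.sum_nonneg fun _ _ => norm_nonneg _
    rw [k1]
    calc _ ≤ ‖H t‖ * ‖g t‖ * ‖S.A t l l - S.A t j j‖ + ‖E t * S.src z w l t‖ * ‖g t‖ +
          ‖H t‖ * ‖deriv g t‖ := by
          refine (norm_add₃_le).trans_eq ?_
          simp only [norm_mul]
      _ ≤ a * B * M * G * (‖S.A t l l‖ + ‖S.A t j j‖) + a * M * (∑ r, ‖S.Q z l r t‖) * G +
          a * B * M * ‖deriv g t‖ := by
          have := hHb t htI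
          have := hG t
          have := norm_sub_le (S.A t l l) (S.A t j j)
          gcongr
      _ = Rt t := by
          simp only [hRt]
          ring
  have hend : ∀ t ∈ Icc c d, ‖E t * V t * g t‖ ≤ a * B * M * G := by
    intro t ht
    rw [← hHE t (hc.trans ht.1), norm_mul]
    exact mul_le_mul (hHb t ht) (hG t) (norm_nonneg _) ((norm_nonneg _).trans (hHb t ht))
  have hLeq : ∫ t in c..d, L t = z * (S.b l - S.b j) *
      ∫ t in c..d, Complex.exp (S.θ j z x - S.θ j z t) * v t l * (g t * (S.ρ t : ℂ)) := by
    rw [← intervalIntegral.integral_const_mul]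
    refine intervalIntegral.integral_congr fun t ht => ?_
    rw [hu] at ht
    simp only [hL]
    rw [← hHE t (hc.trans ht.1)]
  rw [← norm_mul, ← norm_mul, ← hLeq]
  have hfin : ∫ t in c..d, L t = (E d * V d * g d - E c * V c * g c) -
      ∫ t in c..d, (F' t - L t) := by
    rw [intervalIntegral.integral_sub hF'int hLint, hFTC]
    ring
  rw [hfin]
  refine (norm_sub_le _ _).trans ((add_le_add ((norm_sub_le _ _).trans
    (add_le_add (hend d (right_mem_Icc.2 hcd)) (hend c (left_mem_Icc.2 hcd))))
    (hrest.trans hRt_le)).trans_eq ?_)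
  unfold oscConst
  ring

end System

/-! ### Smallness of the squared operator -/

namespace System

variable {n : ℕ} (S : System n) {α : ℝ} {P : Fin n → Prop} [DecidablePred P] {z : ℂ} {μ : ℝ}

/-- The oscillating part of the squared operator is small for large values of the parameter. -/
theorem exists_forall_norm_integral_fker_le (hα : 0 ≤ α) (P : Fin n → Prop) [DecidablePred P]
    {j l : Fin n} (hjl : S.b l ≠ S.b j) {β ε : ℝ} (hβ0 : 0 ≤ β) (hε : 0 < ε) :
    ∃ R : ℝ, 0 < R ∧ ∀ z : ℂ, R ≤ ‖z‖ → ∀ μ : ℝ, (∀ j, P j → (z * S.b j).re ≤ μ) →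
      (∀ j, ¬ P j → μ ≤ (z * S.b j).re) → (∀ j, ∑ l, ∫ t in Ici α, ‖S.Q z j l t‖ ≤ β) →
      ∀ w : ℝ → Fin n → ℂ, (∀ j, Measurable fun x => w x j) → ∀ a, 0 ≤ a →
      (∀ x j, ‖w x j‖ ≤ a * S.wt α μ x) → ∀ x,
      ‖∫ t, S.fker α P j z x t * kerOp (S.fker α P) S.Q z w t l * S.A t j l
        ∂(volume.restrict (Ici (0 : ℝ)))‖ ≤ a * ε * S.wt α μ x := by
  have hD := S.D_pos
  set B := S.D * β with hB
  have hB0 : 0 ≤ B := mul_nonneg hD.le hβ0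
  -- Chosen so that replacing the coefficient by `g ρ` costs at most `ε / 2`; the `+ 1` keeps the
  -- denominator positive.
  set δ := ε / (2 * (B * S.D + 1)) with hδ
  have hBD : 0 ≤ B * S.D := mul_nonneg hB0 hD.le
  have hδ0 : 0 < δ := by positivity
  have hδε : B * S.D * δ ≤ ε / 2 := by
    rw [hδ, mul_div_assoc', div_le_div_iff₀ (by positivity) (by positivity)]
    nlinarith
  obtain ⟨g, hg, hg', hgi, hgδ⟩ := exists_smooth_mul_approx S.locInt S.pos (S.intA j l) hδ0
  obtain ⟨G, hG⟩ := hg.exists_bound_of_continuous hg'.continuous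
  set K := |S.oscConst B β G (∫ t, ‖deriv g t‖) j l| with hK
  set Δ := ‖S.b l - S.b j‖ with hΔ
  have hΔ0 : 0 < Δ := norm_pos_iff.2 (sub_ne_zero.2 hjl)
  have hK0 : 0 ≤ K := abs_nonneg _
  -- Beyond this radius `D K ≤ (ε / 2) |z| Δ`, so the oscillating part takes the other `ε / 2`. The
  -- `+ 1` makes the radius positive even if `K = 0`.
  refine ⟨2 * S.D * K / (ε * Δ) + 1, by positivity, ?_⟩
  intro z hz μ hP hN hβ w hwm a ha hw x
  set v := kerOp (S.fker α P) S.Q z w with hv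
  have hvm : ∀ j, Measurable fun x => v x j := measurable_kerOp (fun j => S.measurable_fker j) hwm
  have haB : 0 ≤ a * B := mul_nonneg ha hB0
  have hvb : ∀ x j, ‖v x j‖ ≤ a * B * S.wt α μ x := fun x j =>
    S.norm_kerOp_fker_le hα hP hN ha hw (hβ j) x
  have hz0 : 0 < ‖z‖ := lt_of_lt_of_le (by positivity) hz
  by_cases hx : α ≤ x
  swap
  · have h0 : ∀ t, S.fker α P j z x t = 0 := by
      intro t
      unfold fker
      split_ifs with h1 h2 h2
      · exact absurd (h2.1.le.trans h2.2) hx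
      · rfl
      · exact absurd h2.1 hx
      · rfl
    simp only [h0, zero_mul, integral_zero, norm_zero]
    exact mul_nonneg (mul_nonneg ha hε.le) (S.wt_nonneg _ _ _)
  have hgc : IntegrableOn (fun t => g t * (S.ρ t : ℂ)) (Ici 0) := by
    have := (S.intA j l).integrableOn.sub hgi
    refine this.congr (Eventually.of_forall fun t => ?_)
    simp
  have hfac : ∀ f : ℝ → ℂ, IntegrableOn f (Ici 0) → Integrable
      (fun t => S.fker α P j z x t * v t l * f t) (volume.restrict (Ici (0 : ℝ))) := by
    intro f hf
    refine hf.bdd_mul (c := a * B * (S.D * S.wt α μ x))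
      (((S.measurable_fker j).of_uncurry_left).mul (hvm l)).aestronglyMeasurable
      (Eventually.of_forall fun t => ?_)
    exact S.fker_mul_le hα hP hN haB (fun x => hvb x l) j x t
  have hsplit : ∫ t, S.fker α P j z x t * v t l * S.A t j l ∂(volume.restrict (Ici (0 : ℝ))) =
      (∫ t, S.fker α P j z x t * v t l * (S.A t j l - g t * (S.ρ t : ℂ))
        ∂(volume.restrict (Ici (0 : ℝ)))) +
      ∫ t, S.fker α P j z x t * v t l * (g t * (S.ρ t : ℂ))
        ∂(volume.restrict (Ici (0 : ℝ))) := by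
    rw [← integral_add (hfac _ hgi) (hfac _ hgc)]
    refine integral_congr_ae (Eventually.of_forall fun t => ?_)
    simp only
    ring
  have hfirst : ‖∫ t, S.fker α P j z x t * v t l * (S.A t j l - g t * (S.ρ t : ℂ))
      ∂(volume.restrict (Ici (0 : ℝ)))‖ ≤ a * (ε / 2) * S.wt α μ x := by
    refine (S.norm_integral_fker_le hα hP hN haB (fun x => hvb x l) hgi j x).trans ?_
    have h1 : ∫ t in Ici α, ‖S.A t j l - g t * (S.ρ t : ℂ)‖ ≤ δ :=
      (setIntegral_mono_set hgi.norm (Eventually.of_forall fun _ => norm_nonneg _)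
        (Ici_subset_Ici.2 hα).eventuallyLE).trans hgδ
    have h2 : 0 ≤ a * S.wt α μ x := mul_nonneg ha (S.wt_nonneg _ _ _)
    calc _ ≤ a * B * S.D * S.wt α μ x * δ := mul_le_mul_of_nonneg_left h1
          (mul_nonneg (mul_nonneg haB hD.le) (S.wt_nonneg _ _ _))
      _ = a * S.wt α μ x * (B * S.D * δ) := by ring
      _ ≤ a * S.wt α μ x * (ε / 2) := mul_le_mul_of_nonneg_left hδε h2
      _ = _ := by ring
  obtain ⟨κ, -, hκ⟩ := S.exists_kerOp_fker_eq hα hP hN hwm ha hw l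
  -- the smooth part as an integral over a bounded interval
  have hsecond' : ∃ c d, α ≤ c ∧ c ≤ d ∧ (∀ t ∈ Icc c d,
      ‖Complex.exp (S.θ j z x - S.θ j z t)‖ * S.wt α μ t ≤ S.D * S.wt α μ x) ∧
      ‖∫ t, S.fker α P j z x t * v t l * (g t * (S.ρ t : ℂ))
        ∂(volume.restrict (Ici (0 : ℝ)))‖ =
      ‖∫ t in c..d, Complex.exp (S.θ j z x - S.θ j z t) * v t l * (g t * (S.ρ t : ℂ))‖ := by
    by_cases hj : P j
    · refine ⟨α, x, le_rfl, hx, fun t ht => S.norm_exp_mul_wt_le hα hP hN j hx ht.1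
        (fun _ => ht.2) (fun h => absurd hj h), ?_⟩
      congr 1
      have h1 : ∀ t, S.fker α P j z x t * v t l * (g t * (S.ρ t : ℂ)) =
          if t ∈ Ioc α x then
            Complex.exp (S.θ j z x - S.θ j z t) * v t l * (g t * (S.ρ t : ℂ)) else 0 := by
        intro t
        by_cases ht : α < t ∧ t ≤ x
        · simp [fker, hj, ht]
        · rw [if_neg (c := t ∈ Ioc α x) ht]
          simp [fker, hj, ht]
      simp only [h1]
      rw [integral_ite_halfLine measurableSet_Ioc
        (Ioc_subset_Icc_self.trans (Icc_subset_Ici_self.trans (Ici_subset_Ici.2 hα))),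
        intervalIntegral.integral_of_le hx]
    -- The compact support of `g` cuts the integral from infinity down to a bounded interval.
    · obtain ⟨X, hX⟩ := hg.isCompact.bddAbove
      have hXg : ∀ t, X < t → g t = 0 := fun t ht =>
        image_eq_zero_of_notMem_tsupport fun h => (hX h).not_gt ht
      refine ⟨x, max x X, hx, le_max_left _ _, fun t ht => S.norm_exp_mul_wt_le hα hP hN j hx
        (hx.trans ht.1) (fun h => absurd h hj) (fun _ => ht.1), ?_⟩
      rw [← norm_neg]
      congr 1
      have h1 : ∀ t, S.fker α P j z x t * v t l * (g t * (S.ρ t : ℂ)) =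
          if t ∈ Ioi x then
            -(Complex.exp (S.θ j z x - S.θ j z t) * v t l * (g t * (S.ρ t : ℂ))) else 0 := by
        intro t
        by_cases ht : x < t
        · simp [fker, hj, ht, hx]
        · simp [fker, hj, ht]
      simp only [h1]
      rw [integral_ite_halfLine measurableSet_Ioi
        (Ioi_subset_Ici_self.trans (Ici_subset_Ici.2 (hα.trans hx))), integral_neg, neg_neg,
        intervalIntegral.integral_of_le (le_max_left _ _)]
      refine setIntegral_eq_of_subset_of_forall_sdiff_eq_zero measurableSet_Ioi
        Ioc_subset_Ioi_self fun t ht => ?_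
      have : X < t := by
        by_contra h
        exact ht.2 ⟨ht.1, (not_lt.1 h).trans (le_max_right _ _)⟩
      rw [hXg t this, zero_mul, mul_zero]
  obtain ⟨c, d, hc, hcd, hM, hEq⟩ := hsecond'
  have hosc := S.norm_mul_integral_le hα hwm ha hB0 hw hvb hκ (hβ l) hg hg' hG hc hcd hM
  rw [← hEq, ← hΔ] at hosc
  have hsecond : ‖∫ t, S.fker α P j z x t * v t l * (g t * (S.ρ t : ℂ))
      ∂(volume.restrict (Ici (0 : ℝ)))‖ ≤ a * (ε / 2) * S.wt α μ x := by
    have h1 : S.D * K ≤ ε / 2 * (‖z‖ * Δ) := by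
      have h2 : 2 * S.D * K / (ε * Δ) ≤ ‖z‖ := by linarith
      rw [div_le_iff₀ (by positivity)] at h2
      linarith
    have h3 : 0 ≤ a * S.wt α μ x := mul_nonneg ha (S.wt_nonneg _ _ _)
    refine le_of_mul_le_mul_left ?_ (mul_pos hz0 hΔ0)
    calc _ ≤ _ := hosc
      _ ≤ a * (S.D * S.wt α μ x) * K := mul_le_mul_of_nonneg_left (le_abs_self _)
          (mul_nonneg ha (mul_nonneg hD.le (S.wt_nonneg _ _ _)))
      _ = a * S.wt α μ x * (S.D * K) := by ring
      _ ≤ a * S.wt α μ x * (ε / 2 * (‖z‖ * Δ)) := mul_le_mul_of_nonneg_left h1 h3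
      _ = _ := by ring
  rw [hsplit]
  refine (norm_add_le _ _).trans ((add_le_add hfirst hsecond).trans_eq ?_)
  ring

/-- The bounds for the integral operator which make the successive approximations converge for
`r ≤ |z|`. -/
def Contractive (α : ℝ) (P : Fin n → Prop) [DecidablePred P] (r B : ℝ) : Prop :=
  ∀ z : ℂ, r ≤ ‖z‖ → ∀ μ : ℝ, (∀ j, P j → (z * S.b j).re ≤ μ) →
    (∀ j, ¬ P j → μ ≤ (z * S.b j).re) →
    ∀ w : ℝ → Fin n → ℂ, (∀ j, Measurable fun x => w x j) → ∀ a, 0 ≤ a →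
    (∀ x j, ‖w x j‖ ≤ a * S.wt α μ x) →
    (∀ x j, ‖kerOp (S.fker α P) S.Q z w x j‖ ≤ a * B * S.wt α μ x) ∧
    ∀ x j, ‖kerOp (S.fker α P) S.Q z (kerOp (S.fker α P) S.Q z w) x j‖ ≤ a / 2 * S.wt α μ x

theorem sum_integral_norm_Q_le {γ : ℝ} (hα : 0 ≤ α) (z : ℂ) (j : Fin n)
    (hγ : ∀ j l, ∫ t in Ici α, ‖S.C z j l t‖ ≤ γ) :
    ∑ l, ∫ t in Ici α, ‖S.Q z j l t‖ ≤
      (∑ j, ∑ l, ∫ t in Ici α, ‖S.A t j l‖) + n * γ := by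
  have hC : ∀ l, IntegrableOn (fun t => ‖S.C z j l t‖) (Ici α) := fun l =>
    IntegrableOn.mono_set (t := Ici 0) (L1.integrable_coeFn (S.C z j l)).norm
      (Ici_subset_Ici.2 hα)
  have h1 : ∀ l, ∫ t in Ici α, ‖S.Q z j l t‖ ≤ (∫ t in Ici α, ‖S.A t j l‖) + γ := by
    intro l
    refine le_trans ?_ (add_le_add_right (hγ j l) _)
    rw [← integral_add (S.intA j l).norm.integrableOn (hC l)]
    refine integral_mono_ae ((S.integrableOn_Q z j l).mono_set (Ici_subset_Ici.2 hα)).norm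
      ((S.intA j l).norm.integrableOn.add (hC l)) ?_
    filter_upwards [ae_restrict_of_ae_restrict_of_subset (Ici_subset_Ici.2 hα) (S.Q_ae z j l)]
      with t ht
    rw [ht]
    refine (norm_add_le _ _).trans (add_le_add_left ?_ _)
    split_ifs
    · simp
    · exact le_rfl
  refine (Finset.sum_le_sum fun l _ => h1 l).trans ?_
  rw [Finset.sum_add_distrib]
  refine add_le_add ?_ (by simp)
  exact Finset.single_le_sum (f := fun j => ∑ l, ∫ t in Ici α, ‖S.A t j l‖)
    (fun j _ => Finset.sum_nonneg fun l _ => integral_nonneg fun _ => norm_nonneg _)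
    (Finset.mem_univ j)

/-- If the tail of the coefficients is small enough, the operator already halves the weighted norm.
No lower bound on `|z|` is needed beyond the one that makes `C` small. -/
theorem contractive_of_small (hα : 0 ≤ α) {r β : ℝ} (hβ : S.D * β ≤ 1 / 2)
    (h : ∀ z : ℂ, r ≤ ‖z‖ → ∀ j, ∑ l, ∫ t in Ici α, ‖S.Q z j l t‖ ≤ β) :
    S.Contractive α P r (1 / 2) := by
  intro z hz μ hP hN w hwm a ha hw
  have hb : ∀ a : ℝ, 0 ≤ a → ∀ w : ℝ → Fin n → ℂ, (∀ x j, ‖w x j‖ ≤ a * S.wt α μ x) →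
      ∀ x j, ‖kerOp (S.fker α P) S.Q z w x j‖ ≤ a * (1 / 2) * S.wt α μ x := by
    intro a ha w hw x j
    refine (S.norm_kerOp_fker_le hα hP hN ha hw (h z hz j) x).trans ?_
    exact mul_le_mul_of_nonneg_right (mul_le_mul_of_nonneg_left hβ ha) (S.wt_nonneg _ _ _)
  have h1 := hb a ha w hw
  refine ⟨h1, fun x j => (hb _ (by positivity) _ h1 x j).trans ?_⟩
  refine mul_le_mul_of_nonneg_right ?_ (S.wt_nonneg _ _ _)
  linarith

/-- For fixed `α` the norm `B` of the operator may exceed `1`. In the square, each entry of `A` off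
the diagonal is small by oscillation, each entry of `C` by its norm, and the diagonal of `A` is
already in the exponents. -/
theorem exists_contractive (hα : 0 ≤ α) (P : Fin n → Prop) [DecidablePred P]
    (hb : Function.Injective S.b)
    (hC : ∀ j l, Tendsto (fun z => ‖S.C z j l‖) (Bornology.cobounded ℂ) (𝓝 0)) :
    ∃ r B : ℝ, 0 < r ∧ 0 ≤ B ∧ S.Contractive α P r B := by
  have hD := S.D_pos
  set β : ℝ := (∑ j, ∑ l, ∫ t in Ici α, ‖S.A t j l‖) + n * 1 with hβ
  have hβ0 : 0 ≤ β := by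
    have : 0 ≤ ∑ j, ∑ l, ∫ t in Ici α, ‖S.A t j l‖ := Finset.sum_nonneg fun j _ =>
      Finset.sum_nonneg fun l _ => integral_nonneg fun _ => norm_nonneg _
    positivity
  set B := S.D * β with hB
  have hB0 : 0 ≤ B := mul_nonneg hD.le hβ0
  -- Each of the `n` summands is bounded with `2ε`, and `2nε ≤ 1/2`.
  set ε : ℝ := 1 / (4 * (n + 1)) with hε
  have hε0 : 0 < ε := by positivity
  -- The bound `1` gives the a priori value `β`; the second one makes the contribution of `C` to the
  -- square at most `ε`.
  set γ : ℝ := min 1 (ε / (B * S.D + 1)) with hγ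
  have hBD : 0 ≤ B * S.D := mul_nonneg hB0 hD.le
  have hγ0 : 0 < γ := lt_min one_pos (by positivity)
  have hγε : B * S.D * γ ≤ ε := by
    calc B * S.D * γ ≤ B * S.D * (ε / (B * S.D + 1)) :=
          mul_le_mul_of_nonneg_left (min_le_right _ _) hBD
      _ ≤ ε := by
          rw [mul_div_assoc', div_le_iff₀ (by positivity)]
          nlinarith
  have hR : ∀ j l : Fin n, ∃ R : ℝ, 0 < R ∧ (j ≠ l → ∀ z : ℂ, R ≤ ‖z‖ → ∀ μ : ℝ,
      (∀ j, P j → (z * S.b j).re ≤ μ) →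
      (∀ j, ¬ P j → μ ≤ (z * S.b j).re) → (∀ j, ∑ l, ∫ t in Ici α, ‖S.Q z j l t‖ ≤ β) →
      ∀ w : ℝ → Fin n → ℂ, (∀ j, Measurable fun x => w x j) → ∀ a, 0 ≤ a →
      (∀ x j, ‖w x j‖ ≤ a * S.wt α μ x) → ∀ x,
      ‖∫ t, S.fker α P j z x t * kerOp (S.fker α P) S.Q z w t l * S.A t j l
        ∂(volume.restrict (Ici (0 : ℝ)))‖ ≤ a * ε * S.wt α μ x) := by
    intro j l
    by_cases hjl : j = l
    · exact ⟨1, one_pos, fun h => absurd hjl h⟩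
    · obtain ⟨R, hR0, hR⟩ := S.exists_forall_norm_integral_fker_le hα P
        (fun h => hjl (hb h).symm : S.b l ≠ S.b j) hβ0 hε0
      exact ⟨R, hR0, fun _ => hR⟩
  choose R hR0 hR using hR
  have hCR : ∃ R' : ℝ, ∀ z : ℂ, R' ≤ ‖z‖ → ∀ j l, ‖S.C z j l‖ ≤ γ := by
    have h1 : ∀ᶠ z in Bornology.cobounded ℂ, ∀ j l, ‖S.C z j l‖ ≤ γ :=
      eventually_all.2 fun j => eventually_all.2 fun l =>
        (hC j l).eventually (eventually_le_nhds hγ0)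
    obtain ⟨R', -, hR'⟩ := (Filter.hasBasis_cobounded_norm (E := ℂ)).eventually_iff.1 h1
    exact ⟨R', fun z hz => hR' hz⟩
  obtain ⟨R', hR'⟩ := hCR
  -- All `R j l` are positive, so their sum serves as a common upper bound.
  refine ⟨max 1 R' + ∑ j, ∑ l, R j l, B, ?_, hB0, ?_⟩
  · have : 0 ≤ ∑ j, ∑ l, R j l :=
      Finset.sum_nonneg fun j _ => Finset.sum_nonneg fun l _ => (hR0 j l).le
    have := le_max_left 1 R'
    linarith
  intro z hz μ hP hN w hwm a ha hw
  have hs0 : 0 ≤ ∑ j, ∑ l, R j l :=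
    Finset.sum_nonneg fun j _ => Finset.sum_nonneg fun l _ => (hR0 j l).le
  have hz' : R' ≤ ‖z‖ := by linarith [le_max_right 1 R']
  have hzR : ∀ j l, R j l ≤ ‖z‖ := by
    intro j l
    have h1 : R j l ≤ ∑ l, R j l :=
      Finset.single_le_sum (f := fun l => R j l) (fun l _ => (hR0 j l).le) (Finset.mem_univ l)
    have h2 : ∑ l, R j l ≤ ∑ j, ∑ l, R j l :=
      Finset.single_le_sum (f := fun j => ∑ l, R j l)
        (fun j _ => Finset.sum_nonneg fun l _ => (hR0 j l).le) (Finset.mem_univ j)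
    linarith [le_max_left 1 R']
  have hCi : ∀ j l, IntegrableOn (S.C z j l) (Ici 0) := fun j l => L1.integrable_coeFn _
  have hCγ : ∀ j l, ∫ t in Ici α, ‖S.C z j l t‖ ≤ γ := by
    intro j l
    refine le_trans ?_ (hR' z hz' j l)
    rw [L1.norm_eq_integral_norm]
    exact setIntegral_mono_set (hCi j l).norm (Eventually.of_forall fun _ => norm_nonneg _)
      (Ici_subset_Ici.2 hα).eventuallyLE
  have hQβ : ∀ j, ∑ l, ∫ t in Ici α, ‖S.Q z j l t‖ ≤ β := fun j =>
    S.sum_integral_norm_Q_le hα z j fun j l => (hCγ j l).trans (min_le_left _ _)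
  set v := kerOp (S.fker α P) S.Q z w with hv
  have hvm : ∀ j, Measurable fun x => v x j := measurable_kerOp (fun j => S.measurable_fker j) hwm
  have haB : 0 ≤ a * B := mul_nonneg ha hB0
  have hvb : ∀ x j, ‖v x j‖ ≤ a * B * S.wt α μ x := fun x j =>
    S.norm_kerOp_fker_le hα hP hN ha hw (hQβ j) x
  refine ⟨hvb, fun x j => ?_⟩
  have hW := S.wt_nonneg α μ x
  have hfac : ∀ l, ∀ f : ℝ → ℂ, IntegrableOn f (Ici 0) → Integrable
      (fun t => S.fker α P j z x t * v t l * f t) (volume.restrict (Ici (0 : ℝ))) := by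
    intro l f hf
    refine hf.bdd_mul (c := a * B * (S.D * S.wt α μ x))
      (((S.measurable_fker j).of_uncurry_left).mul (hvm l)).aestronglyMeasurable
      (Eventually.of_forall fun t => ?_)
    exact S.fker_mul_le hα hP hN haB (fun x => hvb x l) j x t
  have hterm : ∀ l, ‖∫ t, S.fker α P j z x t * v t l * S.Q z j l t
      ∂(volume.restrict (Ici (0 : ℝ)))‖ ≤ a * ε * S.wt α μ x + a * ε * S.wt α μ x := by
    intro l
    have hCpart : ‖∫ t, S.fker α P j z x t * v t l * S.C z j l t
        ∂(volume.restrict (Ici (0 : ℝ)))‖ ≤ a * ε * S.wt α μ x := by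
      refine (S.norm_integral_fker_le hα hP hN haB (fun x => hvb x l) (hCi j l) j x).trans ?_
      calc _ ≤ a * B * S.D * S.wt α μ x * γ := mul_le_mul_of_nonneg_left (hCγ j l)
            (mul_nonneg (mul_nonneg haB hD.le) hW)
        _ = a * S.wt α μ x * (B * S.D * γ) := by ring
        _ ≤ a * S.wt α μ x * ε := mul_le_mul_of_nonneg_left hγε (mul_nonneg ha hW)
        _ = _ := by ring
    by_cases hjl : j = l
    · have : ∫ t, S.fker α P j z x t * v t l * S.Q z j l t ∂(volume.restrict (Ici (0 : ℝ))) =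
          ∫ t, S.fker α P j z x t * v t l * S.C z j l t ∂(volume.restrict (Ici (0 : ℝ))) := by
        refine integral_congr_ae ?_
        filter_upwards [S.Q_ae z j l] with t ht
        rw [ht, if_pos hjl, zero_add]
      rw [this]
      exact hCpart.trans (le_add_of_nonneg_left (mul_nonneg (mul_nonneg ha hε0.le) hW))
    · have : ∫ t, S.fker α P j z x t * v t l * S.Q z j l t ∂(volume.restrict (Ici (0 : ℝ))) =
          (∫ t, S.fker α P j z x t * v t l * S.A t j l ∂(volume.restrict (Ici (0 : ℝ)))) +
          ∫ t, S.fker α P j z x t * v t l * S.C z j l t ∂(volume.restrict (Ici (0 : ℝ))) := by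
        rw [← integral_add (hfac l _ (S.intA j l).integrableOn) (hfac l _ (hCi j l))]
        refine integral_congr_ae ?_
        filter_upwards [S.Q_ae z j l] with t ht
        rw [ht, if_neg hjl, mul_add]
      rw [this]
      exact (norm_add_le _ _).trans (add_le_add
        (hR j l hjl z (hzR j l) μ hP hN hQβ w hwm a ha hw x) hCpart)
  refine (norm_sum_le _ _).trans ((Finset.sum_le_sum fun l _ => hterm l).trans ?_)
  rw [Finset.sum_const, Finset.card_univ, Fintype.card_fin, nsmul_eq_mul]
  have h1 : (n : ℝ) * ε ≤ 1 / 4 := by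
    rw [hε, mul_one_div, div_le_div_iff₀ (by positivity) (by norm_num)]
    linarith
  have h2 : 0 ≤ a * S.wt α μ x := mul_nonneg ha hW
  nlinarith

end System

/-! ### Solutions of the integral equations on `[α, ∞)` and on `[0, α]` -/

namespace System

variable {n : ℕ} (S : System n) {α : ℝ}

theorem differentiable_exp_θ_sub (j : Fin n) (x t : ℝ) :
    Differentiable ℂ fun z => Complex.exp (S.θ j z x - S.θ j z t) :=
  ((S.differentiable_θ j x).sub (S.differentiable_θ j t)).cexp

theorem differentiable_fker (P : Fin n → Prop) [DecidablePred P] (j : Fin n) (x t : ℝ) :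
    Differentiable ℂ fun z => S.fker α P j z x t := by
  unfold fker
  split_ifs
  · exact S.differentiable_exp_θ_sub j x t
  · exact differentiable_const _
  · exact (S.differentiable_exp_θ_sub j x t).neg
  · exact differentiable_const _

/-- The solutions of the integral equations on `[α, ∞)`. -/
theorem exists_forward (hα : 0 ≤ α) (P : Fin n → Prop) [DecidablePred P] {r B : ℝ} (hr : 0 < r)
    (hB0 : 0 ≤ B) (hc : S.Contractive α P r B) {Z U : Set ℂ} (hU : IsOpen U) (hUZ : U ⊆ Z)
    (hZ : ∀ z ∈ Z, r ≤ ‖z‖) {μ : ℂ → ℝ} (hμ : ∀ z, |μ z| ≤ ‖z‖)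
    (hP : ∀ z ∈ Z, ∀ j, P j → (z * S.b j).re ≤ μ z)
    (hN : ∀ z ∈ Z, ∀ j, ¬ P j → μ z ≤ (z * S.b j).re) {k : Fin n} (hk : P k) :
    ∃ u : ℂ → ℝ → Fin n → ℂ, (∀ z ∈ Z, ∀ j, Measurable fun x => u z x j) ∧
      (∀ z ∈ Z, ∀ x j, ‖u z x j‖ ≤ 8 * S.D * (1 + B) * S.wt α (μ z) x) ∧
      (∀ z ∈ Z, ∀ j, ∃ κ : ℂ, (P j → κ = if j = k then Complex.exp (-S.θ k z α) else 0) ∧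
        ∀ x, α ≤ x → u z x j =
          Complex.exp (S.θ j z x) * (κ + ∫ t in α..x, S.src z (u z) j t)) ∧
      (∀ x j, ContinuousOn (fun z => u z x j) Z) ∧
      ∀ x j, DifferentiableOn ℂ (fun z => u z x j) U := by
  have hD := S.D_pos
  have hZ0 : Z ⊆ {0}ᶜ := fun z hz h0 => by
    have := hZ z hz
    rw [mem_singleton_iff.1 h0, norm_zero] at this
    linarith
  -- The free term solves the diagonal equation in the component `k`, normalized to `1` at `α`.
  set f : ℂ → ℝ → Fin n → ℂ := fun z x j =>
    if α ≤ x ∧ j = k then Complex.exp (S.θ k z x - S.θ k z α) else 0 with hf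
  have hfd : ∀ x j, Differentiable ℂ fun z => f z x j := by
    intro x j
    simp only [hf]
    split_ifs
    · exact S.differentiable_exp_θ_sub k x α
    · exact differentiable_const _
  have hfm : ∀ z, ∀ j, Measurable fun x => f z x j := by
    intro z j
    by_cases hjk : j = k
    · simp only [hf, hjk, and_true]
      refine Measurable.ite (measurableSet_le measurable_const measurable_id) ?_ measurable_const
      exact ((S.continuous_θ k z).sub continuous_const).cexp.measurable
    · simp only [hf, hjk, and_false, if_false]
      exact measurable_const
  have hwα : ∀ z, S.wt α (μ z) α = 1 := fun z => by simp [wt]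
  have hfb : ∀ z ∈ Z, ∀ x j, ‖f z x j‖ ≤ S.D * S.wt α (μ z) x := by
    intro z hz x j
    simp only [hf]
    split_ifs with h
    · have := S.norm_exp_mul_wt_le hα (hP z hz) (hN z hz) k h.1 le_rfl (fun _ => h.1)
        (fun h' => absurd hk h')
      rwa [hwα, mul_one] at this
    · rw [norm_zero]
      exact mul_nonneg hD.le (S.wt_nonneg _ _ _)
  -- The bound `|μ z| ≤ |z|` controls the weight locally; continuity of `μ` is not needed.
  have hloc : ∀ x, ∀ z₀ ∈ Z, ∃ M, ∀ᶠ z in 𝓝[Z] z₀, S.wt α (μ z) x ≤ M ∧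
      ∀ t j, ‖S.fker α P j z x t‖ * S.wt α (μ z) t ≤ M := by
    intro x z₀ hz₀
    set M₀ := Real.exp ((‖z₀‖ + 1) * |S.p x - S.p α|) with hM₀
    have hM₀0 : 0 < M₀ := Real.exp_pos _
    refine ⟨(1 + S.D) * M₀, ?_⟩
    have h1 : ∀ᶠ z in 𝓝[Z] z₀, ‖z‖ < ‖z₀‖ + 1 := mem_nhdsWithin_of_mem_nhds
      (continuous_norm.continuousAt.eventually (gt_mem_nhds (lt_add_one _)))
    filter_upwards [h1, self_mem_nhdsWithin] with z hz hzZ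
    have h2 : S.wt α (μ z) x ≤ M₀ := by
      unfold wt
      split_ifs
      · refine Real.exp_le_exp.2 ((le_abs_self _).trans ?_)
        rw [abs_mul]
        exact mul_le_mul_of_nonneg_right ((hμ z).trans hz.le) (abs_nonneg _)
      · exact hM₀0.le
    refine ⟨by nlinarith, fun t j => ?_⟩
    refine (S.norm_fker_mul_wt_le hα (hP z hzZ) (hN z hzZ) j x t).trans ?_
    nlinarith [mul_le_mul_of_nonneg_left h2 hD.le]
  obtain ⟨u, hum, hub, hu, huZ, huU⟩ := exists_fixedPoint_kerOp (k := S.fker α P) (q := S.Q) hU hUZ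
    (W := fun z => S.wt α (μ z)) (fun z x => S.wt_nonneg _ _ _)
    (fun j l => (S.differentiableOn_Q j l).continuousOn.mono hZ0)
    (fun j l => (S.differentiableOn_Q j l).mono (hUZ.trans hZ0))
    (fun z _ j => S.measurable_fker j)
    (fun j x t => (S.differentiable_fker P j x t).continuous.continuousOn)
    (fun j x t => (S.differentiable_fker P j x t).differentiableOn) hloc hB0
    (fun z hz => hc z (hZ z hz) (μ z) (hP z hz) (hN z hz)) (f := f) hD.le
    (fun z _ => hfm z) hfb (fun x j => (hfd x j).continuous.continuousOn)
    (fun x j => (hfd x j).differentiableOn)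
  refine ⟨u, hum, hub, fun z hz j => ?_, huZ, huU⟩
  obtain ⟨κ, hκ0, hκ⟩ := S.exists_kerOp_fker_eq hα (hP z hz) (hN z hz) (hum z hz)
    (a := 8 * S.D * (1 + B)) (by positivity) (hub z hz) j
  refine ⟨(if j = k then Complex.exp (-S.θ k z α) else 0) + κ, fun h => by
    rw [hκ0 h, add_zero], fun x hx => ?_⟩
  have h1 : f z x j =
      Complex.exp (S.θ j z x) * (if j = k then Complex.exp (-S.θ k z α) else 0) := by
    by_cases hjk : j = k
    · subst hjk
      simp only [hf, hx, and_self, if_true]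
      rw [← Complex.exp_add, sub_eq_add_neg]
    · simp [hf, hjk]
  rw [hu z hz x j, hκ x hx, h1]
  ring

/-- The kernel of the integral equation on `[0, α]`. -/
noncomputable def bker (α : ℝ) (j : Fin n) (z : ℂ) (x t : ℝ) : ℂ :=
  if 0 ≤ x ∧ x < t ∧ t ≤ α then -Complex.exp (S.θ j z x - S.θ j z t) else 0

theorem measurable_bker (j : Fin n) (z : ℂ) : Measurable (Function.uncurry (S.bker α j z)) := by
  unfold bker Function.uncurry
  refine Measurable.ite ?_ (S.measurable_exp_θ_sub j z).neg measurable_const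
  exact (measurableSet_le measurable_const measurable_fst).inter
    ((measurableSet_lt measurable_fst measurable_snd).inter
      (measurableSet_le measurable_snd measurable_const))

theorem differentiable_bker (j : Fin n) (x t : ℝ) :
    Differentiable ℂ fun z => S.bker α j z x t := by
  unfold bker
  split_ifs
  · exact (S.differentiable_exp_θ_sub j x t).neg
  · exact differentiable_const _

/-- The solutions of the integral equations on `[0, α]` with given values at `α`. -/
theorem exists_backward {Z U : Set ℂ} (hU : IsOpen U) (hUZ : U ⊆ Z)
    (hZ0 : Z ⊆ {0}ᶜ) {c : ℂ → Fin n → ℂ} (hcZ : ∀ j, ContinuousOn (fun z => c z j) Z)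
    (hcU : ∀ j, DifferentiableOn ℂ (fun z => c z j) U) :
    ∃ u : ℂ → ℝ → Fin n → ℂ,
      (∀ z ∈ Z, ∀ j, IntegrableOn (S.src z (u z) j) (Ioc 0 α)) ∧
      (∀ z ∈ Z, ∀ j, ∀ x ∈ Icc 0 α, u z x j =
          Complex.exp (S.θ j z x) * (Complex.exp (-S.θ j z α) * c z j +
            ∫ t in α..x, S.src z (u z) j t)) ∧
      (∀ x j, ContinuousOn (fun z => u z x j) Z) ∧
      ∀ x j, DifferentiableOn ℂ (fun z => u z x j) U := by
  have hD := S.D_pos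
  -- On the bounded interval the signs of `Re(z b_j)` are irrelevant: the exponentials are bounded
  -- using `|z| p(α)`.
  set Dz : ℂ → ℝ := fun z => S.D * Real.exp (‖z‖ * S.p α) with hDz
  have hDz0 : ∀ z, 0 < Dz z := fun z => mul_pos hD (Real.exp_pos _)
  have hp0 : S.p 0 = 0 := intervalIntegral.integral_same
  have hexp : ∀ j z x t, 0 ≤ x → x ≤ t → t ≤ α →
      ‖Complex.exp (S.θ j z x - S.θ j z t)‖ ≤ Dz z := by
    intro j z x t hx hxt ht
    refine (S.norm_exp_θ_sub_le j z x t).trans (mul_le_mul_of_nonneg_left ?_ hD.le)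
    refine Real.exp_le_exp.2 ?_
    have h1 : -‖z‖ ≤ (z * S.b j).re := by
      have h2 := Complex.abs_re_le_norm (z * S.b j)
      rw [norm_mul] at h2
      have h3 := mul_le_mul_of_nonneg_left (S.norm_b j) (norm_nonneg z)
      linarith [neg_abs_le (z * S.b j).re]
    have h4 := S.p_mono le_rfl hx
    have h5 := S.p_mono hx hxt
    have h6 := S.p_mono (hx.trans hxt) ht
    nlinarith [norm_nonneg z]
  set q : ℂ → ℝ → ℝ := fun z t => ∑ j, ∑ l, ‖S.Q z j l t‖ with hq
  have hq0 : ∀ z t, 0 ≤ q z t := fun z t =>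
    Finset.sum_nonneg fun _ _ => Finset.sum_nonneg fun _ _ => norm_nonneg _
  have hqi : ∀ z, IntegrableOn (q z) (Ici 0) := fun z =>
    integrable_finsetSum _ fun j _ => integrable_finsetSum _ fun l _ =>
      (S.integrableOn_Q z j l).norm
  have hqN : ∀ z, ∫ t in Ici 0, q z t = ∑ j, ∑ l, ‖S.Q z j l‖ := by
    intro z
    rw [integral_finsetSum _ fun j _ => integrable_finsetSum _ fun l _ =>
      (S.integrableOn_Q z j l).norm]
    refine Finset.sum_congr rfl fun j _ => ?_
    rw [integral_finsetSum _ fun l _ => (S.integrableOn_Q z j l).norm]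
    exact Finset.sum_congr rfl fun l _ => (L1.norm_eq_integral_norm _).symm
  have hsubI : ∀ x, 0 ≤ x → Ioc x α ⊆ Ici 0 := fun x hx t ht => hx.trans ht.1.le
  have hqii : ∀ z x, 0 ≤ x → x ≤ α → IntervalIntegrable (q z) volume x α := fun z x hx hxα =>
    (intervalIntegrable_iff_integrableOn_Ioc_of_le hxα).2 ((hqi z).mono_set (hsubI x hx))
  have hqle : ∀ z x, 0 ≤ x → x ≤ α → ∫ t in x..α, q z t ≤ ∑ j, ∑ l, ‖S.Q z j l‖ := by
    intro z x hx hxα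
    rw [← hqN, intervalIntegral.integral_of_le hxα]
    exact setIntegral_mono_set (hqi z) (Eventually.of_forall (hq0 z)) (hsubI x hx).eventuallyLE
  have hqnn : ∀ z x, x ≤ α → 0 ≤ ∫ t in x..α, q z t := fun z x hxα =>
    intervalIntegral.integral_nonneg hxα fun t _ => hq0 z t
  set F : ℂ → ℝ := fun z => Dz z * ∑ j, ‖c z j‖ with hF
  have hF0 : ∀ z, 0 ≤ F z := fun z =>
    mul_nonneg (hDz0 z).le (Finset.sum_nonneg fun _ _ => norm_nonneg _)
  -- The factor `F` makes the free term at most `1 · W`. The exponent `2 Dz ∫ q` is chosen so that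
  -- the Gronwall estimate gives the operator norm `Dz / (2 Dz) = 1/2`.
  set W : ℂ → ℝ → ℝ := fun z x =>
    if 0 ≤ x ∧ x ≤ α then F z * Real.exp (2 * Dz z * ∫ t in x..α, q z t) else 0 with hW
  have hW0 : ∀ z x, 0 ≤ W z x := by
    intro z x
    simp only [hW]
    split_ifs
    · exact mul_nonneg (hF0 z) (Real.exp_pos _).le
    · exact le_rfl
  -- A bound for the weight that is uniform in `x` and continuous in `z`, as local boundedness
  -- requires.
  set Wb : ℂ → ℝ := fun z => F z * Real.exp (2 * Dz z * ∑ j, ∑ l, ‖S.Q z j l‖) with hWb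
  have hWb0 : ∀ z, 0 ≤ Wb z := fun z => mul_nonneg (hF0 z) (Real.exp_pos _).le
  have hWle : ∀ z x, W z x ≤ Wb z := by
    intro z x
    simp only [hW]
    split_ifs with h
    · refine mul_le_mul_of_nonneg_left (Real.exp_le_exp.2 ?_) (hF0 z)
      exact mul_le_mul_of_nonneg_left (hqle z x h.1 h.2) (by linarith [hDz0 z])
    · exact hWb0 z
  have hQZ : ∀ j l, ContinuousOn (fun z => S.Q z j l) Z := fun j l =>
    (S.differentiableOn_Q j l).continuousOn.mono hZ0
  have hDzc : Continuous Dz := by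
    simp only [hDz]
    fun_prop
  have hWbc : ContinuousOn Wb Z := by
    have h1 : ContinuousOn F Z := hDzc.continuousOn.mul
      (continuousOn_finsetSum _ fun j _ => (hcZ j).norm)
    have h2 : ContinuousOn (fun z => ∑ j, ∑ l, ‖S.Q z j l‖) Z :=
      continuousOn_finsetSum _ fun j _ => continuousOn_finsetSum _ fun l _ => (hQZ j l).norm
    exact h1.mul (((continuousOn_const.mul hDzc.continuousOn).mul h2).rexp)
  have hkb : ∀ j z x t, ‖S.bker α j z x t‖ ≤ Dz z := by
    intro j z x t
    unfold bker
    split_ifs with h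
    · rw [norm_neg]
      exact hexp j z x t h.1 h.2.1.le h.2.2
    · rw [norm_zero]
      exact (hDz0 z).le
  have hloc : ∀ x, ∀ z₀ ∈ Z, ∃ M, ∀ᶠ z in 𝓝[Z] z₀, W z x ≤ M ∧
      ∀ t j, ‖S.bker α j z x t‖ * W z t ≤ M := by
    intro x z₀ hz₀
    refine ⟨(1 + Dz z₀) * Wb z₀ + 1, ?_⟩
    have h1 : ContinuousWithinAt (fun z => (1 + Dz z) * Wb z) Z z₀ :=
      ((continuousOn_const.add hDzc.continuousOn).mul hWbc) z₀ hz₀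
    filter_upwards [h1.eventually (gt_mem_nhds (lt_add_one _))] with z hz
    have h2 := hWb0 z
    have h3 := hDz0 z
    refine ⟨by nlinarith [hWle z x], fun t j => ?_⟩
    have h4 : ‖S.bker α j z x t‖ * W z t ≤ Dz z * Wb z :=
      mul_le_mul (hkb j z x t) (hWle z t) (hW0 z t) h3.le
    nlinarith
  -- the operator in the form of the variation of constants
  have hrep : ∀ z w a, (∀ j, Measurable fun x => w x j) → 0 ≤ a → (∀ x j, ‖w x j‖ ≤ a * W z x) →
      ∀ x ∈ Icc 0 α, ∀ j, kerOp (S.bker α) S.Q z w x j =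
        Complex.exp (S.θ j z x) * ∫ t in α..x, S.src z w j t := by
    intro z w a hwm ha hw x hx j
    have hint : ∀ l, Integrable (fun t => S.bker α j z x t * w t l * S.Q z j l t)
        (volume.restrict (Ici (0 : ℝ))) := fun l =>
      integrable_mul_Lp (M := Dz z * (a * Wb z)) ((((S.measurable_bker j z).of_uncurry_left).mul
        (hwm l)).aestronglyMeasurable) (fun t => by
          change ‖S.bker α j z x t * w t l‖ ≤ _
          rw [norm_mul]
          exact mul_le_mul (hkb j z x t) ((hw t l).trans (mul_le_mul_of_nonneg_left (hWle z t) ha))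
            (norm_nonneg _) (hDz0 z).le) _
    have h1 : ∀ t, ∑ l, S.bker α j z x t * w t l * S.Q z j l t =
        if t ∈ Ioc x α then -Complex.exp (S.θ j z x) * S.src z w j t else 0 := by
      intro t
      rw [neg_mul, exp_mul_src]
      by_cases ht : x < t ∧ t ≤ α
      · simp [bker, hx.1, ht]
      · rw [if_neg (c := t ∈ Ioc x α) ht]
        simp [bker, ht]
    unfold kerOp
    rw [← integral_finsetSum _ fun l _ => hint l]
    simp only [h1]
    rw [integral_ite_halfLine measurableSet_Ioc (hsubI x hx.1), integral_const_mul,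
      intervalIntegral.integral_of_ge hx.2]
    ring
  have hTb : ∀ z w a, (∀ j, Measurable fun x => w x j) → 0 ≤ a → (∀ x j, ‖w x j‖ ≤ a * W z x) →
      ∀ x j, ‖kerOp (S.bker α) S.Q z w x j‖ ≤ a * (1 / 2) * W z x := by
    intro z w a hwm ha hw x j
    by_cases hx : x ∈ Icc 0 α
    swap
    · have h0 : ∀ t, S.bker α j z x t = 0 := fun t => by
        unfold bker
        exact if_neg fun h => hx ⟨h.1, h.2.1.le.trans h.2.2⟩
      simp only [kerOp, h0, zero_mul, integral_zero, Finset.sum_const_zero, norm_zero]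
      have := hW0 z x
      positivity
    rw [hrep z w a hwm ha hw x hx j, intervalIntegral.integral_symm, mul_neg, norm_neg,
      ← intervalIntegral.integral_const_mul]
    have hκ : 0 < 2 * Dz z := by linarith [hDz0 z]
    have h1 := integral_mul_exp_integral_le hκ (hqii z x hx.1 hx.2)
    have hqe : IntervalIntegrable (fun t => q z t * Real.exp (2 * Dz z * ∫ s in t..α, q z s))
        volume x α := by
      refine (hqii z x hx.1 hx.2).mul_continuousOn ?_
      have : ContinuousOn (fun t => ∫ s in t..α, q z s) (uIcc x α) := by
        refine intervalIntegral.continuousOn_primitive_interval_left ((hqi z).mono_set ?_)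
        rw [uIcc_of_le hx.2]
        exact Icc_subset_Ici_self.trans (Ici_subset_Ici.2 hx.1)
      exact (continuousOn_const.mul this).rexp
    have h2 : ‖∫ t in x..α, Complex.exp (S.θ j z x) * S.src z w j t‖ ≤
        ∫ t in x..α, a * F z * Dz z * (q z t * Real.exp (2 * Dz z * ∫ s in t..α, q z s)) := by
      refine intervalIntegral.norm_integral_le_of_norm_le hx.2 ?_ (hqe.const_mul _)
      refine Eventually.of_forall fun t ht => ?_
      have ht0 : 0 ≤ t := hx.1.trans ht.1.le
      rw [exp_mul_src]
      have h3 : ∀ l, ‖Complex.exp (S.θ j z x - S.θ j z t) * w t l * S.Q z j l t‖ ≤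
          Dz z * (a * (F z * Real.exp (2 * Dz z * ∫ s in t..α, q z s))) * ‖S.Q z j l t‖ := by
        intro l
        rw [norm_mul, norm_mul]
        refine mul_le_mul_of_nonneg_right (mul_le_mul (hexp j z x t hx.1 ht.1.le ht.2) ?_
          (norm_nonneg _) (hDz0 z).le) (norm_nonneg _)
        refine (hw t l).trans_eq ?_
        simp only [hW]
        rw [if_pos ⟨ht0, ht.2⟩]
      refine (norm_sum_le _ _).trans ((Finset.sum_le_sum fun l _ => h3 l).trans ?_)
      rw [← Finset.mul_sum]
      have h4 : ∑ l, ‖S.Q z j l t‖ ≤ q z t :=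
        Finset.single_le_sum (f := fun j => ∑ l, ‖S.Q z j l t‖)
          (fun j _ => Finset.sum_nonneg fun l _ => norm_nonneg _) (Finset.mem_univ j)
      have h5 : 0 ≤ Dz z * (a * (F z * Real.exp (2 * Dz z * ∫ s in t..α, q z s))) :=
        mul_nonneg (hDz0 z).le (mul_nonneg ha (mul_nonneg (hF0 z) (Real.exp_pos _).le))
      refine (mul_le_mul_of_nonneg_left h4 h5).trans_eq ?_
      ring
    refine h2.trans ?_
    rw [intervalIntegral.integral_const_mul]
    refine (mul_le_mul_of_nonneg_left h1
      (mul_nonneg (mul_nonneg ha (hF0 z)) (hDz0 z).le)).trans_eq ?_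
    simp only [hW]
    rw [if_pos ⟨hx.1, hx.2⟩]
    have := (hDz0 z).ne'
    field_simp
  set f : ℂ → ℝ → Fin n → ℂ := fun z x j =>
    if 0 ≤ x ∧ x ≤ α then Complex.exp (S.θ j z x - S.θ j z α) * c z j else 0 with hf
  have hfm : ∀ z, ∀ j, Measurable fun x => f z x j := by
    intro z j
    refine Measurable.ite ((measurableSet_le measurable_const measurable_id).inter
      (measurableSet_le measurable_id measurable_const)) ?_ measurable_const
    exact ((S.measurable_exp_θ_sub j z).comp measurable_prodMk_right).mul_const _
  have hfb : ∀ z ∈ Z, ∀ x j, ‖f z x j‖ ≤ 1 * W z x := by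
    intro z _ x j
    simp only [hf, hW, one_mul]
    split_ifs with h
    · rw [norm_mul]
      have h1 : ‖c z j‖ ≤ ∑ j, ‖c z j‖ :=
        Finset.single_le_sum (f := fun j => ‖c z j‖) (fun _ _ => norm_nonneg _) (Finset.mem_univ j)
      refine (mul_le_mul (hexp j z x α h.1 h.2 le_rfl) h1 (norm_nonneg _) (hDz0 z).le).trans ?_
      refine le_mul_of_one_le_right (hF0 z) (Real.one_le_exp ?_)
      exact mul_nonneg (by linarith [hDz0 z]) (hqnn z x h.2)
    · simp
  have hfZ : ∀ x j, ContinuousOn (fun z => f z x j) Z := by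
    intro x j
    simp only [hf]
    split_ifs
    · exact (S.differentiable_exp_θ_sub j x α).continuous.continuousOn.mul (hcZ j)
    · exact continuousOn_const
  have hfU : ∀ x j, DifferentiableOn ℂ (fun z => f z x j) U := by
    intro x j
    simp only [hf]
    split_ifs
    · exact (S.differentiable_exp_θ_sub j x α).differentiableOn.mul (hcU j)
    · exact differentiableOn_const _
  obtain ⟨u, hum, hub, hu, huZ, huU⟩ := exists_fixedPoint_kerOp (k := S.bker α) (q := S.Q) hU hUZ
    (W := W) hW0 hQZ (fun j l => (S.differentiableOn_Q j l).mono (hUZ.trans hZ0))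
    (fun z _ j => S.measurable_bker j z)
    (fun j x t => (S.differentiable_bker j x t).continuous.continuousOn)
    (fun j x t => (S.differentiable_bker j x t).differentiableOn) hloc (B := 1 / 2) (by norm_num)
    (fun z _ w hwm a ha hw => ⟨hTb z w a hwm ha hw, fun x j => by
      refine (hTb z _ _ (measurable_kerOp (fun j => S.measurable_bker j z) hwm) (by positivity)
        (hTb z w a hwm ha hw) x j).trans ?_
      refine mul_le_mul_of_nonneg_right ?_ (hW0 z x)
      linarith⟩) (f := f) zero_le_one (fun z _ => hfm z) hfb hfZ hfU
  refine ⟨u, fun z hz j => ?_, fun z hz j x hx => ?_, huZ, huU⟩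
  · have hcont : Continuous fun t => ‖Complex.exp (S.θ j z 0 - S.θ j z t)‖ :=
      (continuous_const.sub (S.continuous_θ j z)).cexp.norm
    refine S.integrableOn_src measurableSet_Ioc (hsubI 0 le_rfl) (hum z hz) (x₀ := 0)
      (M := Dz z * (8 * 1 * (1 + 1 / 2) * Wb z)) j fun t ht l => ?_
    rw [norm_mul]
    refine mul_le_mul (hexp j z 0 t le_rfl ht.1.le ht.2) ((hub z hz t l).trans ?_)
      (norm_nonneg _) (hDz0 z).le
    exact mul_le_mul_of_nonneg_left (hWle z t) (by norm_num)
  · rw [hu z hz x j, hrep z (u z) _ (hum z hz) (by norm_num) (hub z hz) x hx j, mul_add]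
    congr 1
    simp only [hf]
    rw [if_pos ⟨hx.1, hx.2⟩, ← mul_assoc, ← Complex.exp_add, sub_eq_add_neg]

end System

/-! ### Solutions on the half-line by gluing at `α` -/

namespace System

variable {n : ℕ} (S : System n) {α : ℝ}

/-- Functions given by the variation of constants solve the system. -/
theorem isSolution_of_eq (hα : 0 ≤ α) {z : ℂ} {u : ℝ → Fin n → ℂ} {κ : Fin n → ℂ}
    (hint : ∀ T j, 0 ≤ T → IntervalIntegrable (S.src z u j) volume 0 T)
    (hu : ∀ x j, 0 ≤ x → u x j =
      Complex.exp (S.θ j z x) * (κ j + ∫ t in α..x, S.src z u j t)) :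
    IsSolution S.ρ S.b S.A S.C z u := by
  set R : Fin n → ℝ → ℂ := fun j x =>
    Complex.exp (S.θ j z x) * (κ j + ∫ t in α..x, S.src z u j t) with hR
  set R' : Fin n → ℝ → ℂ := fun j x =>
    Complex.exp (S.θ j z x) * (z * S.b j * (S.ρ x : ℂ) + S.A x j j) *
      (κ j + ∫ t in α..x, S.src z u j t) + Complex.exp (S.θ j z x) * S.src z u j x with hR'
  have hder : ∀ T j, 0 ≤ T → HasAEDeriv (R j) (R' j) 0 T := by
    intro T j hT
    have h1 : (0 : ℝ) ≤ max T α := le_max_of_le_left hT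
    have h2 : HasAEDeriv (R j) (R' j) 0 (max T α) :=
      (S.hasAEDeriv_θ j z _ _).cexp.mul (HasAEDeriv.primitive (hint _ j h1) α (by
        rw [uIcc_of_le h1]
        exact ⟨hα, le_max_right _ _⟩) (κ j))
    refine h2.mono ?_
    rw [uIcc_of_le hT, uIcc_of_le h1]
    exact Icc_subset_Icc_right (le_max_left _ _)
  refine ⟨fun T hT j => ?_, ?_⟩
  · refine absolutelyContinuousOnInterval_of_dist_le (hder T j hT.le).ac 1 ?_
    intro x hx y hy
    rw [uIcc_of_le hT.le] at hx hy
    rw [one_mul, hu x j hx.1, hu y j hy.1]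
  · have h1 : ∀ᵐ x : ℝ, ∀ (N : ℕ) (j : Fin n), x ∈ uIcc (0 : ℝ) N → HasDerivAt (R j) (R' j x) x :=
      ae_all_iff.2 fun N => ae_all_iff.2 fun j => (hder N j N.cast_nonneg).deriv
    have h2 : ∀ᵐ x : ℝ, x ≠ 0 := by simp [ae_iff, measure_singleton]
    filter_upwards [ae_restrict_of_ae h1, ae_restrict_of_ae h2, ae_restrict_mem measurableSet_Ici,
      ae_all_iff.2 fun j => ae_all_iff.2 fun l => S.Q_ae z j l] with x hx hx0 hx1 hQ
    have hpos : 0 < x := lt_of_le_of_ne hx1 (Ne.symm hx0)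
    obtain ⟨N, hN⟩ := exists_nat_ge x
    refine hasDerivAt_pi.2 fun j => ?_
    have hd := hx N j (by
      rw [uIcc_of_le N.cast_nonneg]
      exact ⟨hpos.le, hN⟩)
    have heq : (fun y => u y j) =ᶠ[𝓝 x] R j := by
      filter_upwards [lt_mem_nhds hpos] with y hy using hu y j hy.le
    refine (hd.congr_of_eventuallyEq heq).congr_deriv ?_
    -- The derivative of the exponent restores `z b_j ρ + a_jj`, and the source term restores the
    -- coefficients in `Q`.
    have hval : R' j x = (z * S.b j * (S.ρ x : ℂ) + S.A x j j) * u x j +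
        ∑ l, u x l * S.Q z j l x := by
      have h3 : Complex.exp (S.θ j z x) * S.src z u j x = ∑ l, u x l * S.Q z j l x := by
        rw [exp_mul_src]
        simp
      simp only [hR']
      rw [h3, hu x j hpos.le]
      ring
    rw [hval]
    have hterm : ∀ l, coeffMatrix S.ρ S.b S.A S.C z x j l * u x l =
        (if j = l then (z * S.b j * (S.ρ x : ℂ) + S.A x j j) * u x l else 0) +
          u x l * S.Q z j l x := by
      intro l
      rw [hQ j l]
      simp only [coeffMatrix, Matrix.add_apply, Matrix.smul_apply, Matrix.of_apply,
        Matrix.diagonal_apply, smul_eq_mul]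
      split_ifs with h
      · subst h
        ring
      · ring
    simp only [Matrix.mulVec, dotProduct, hterm, Finset.sum_add_distrib, Finset.sum_ite_eq,
      Finset.mem_univ, if_true]

/-- The solutions on the half-line determined by their behavior at infinity and by the values at
`α` of the components satisfying `P`. -/
theorem exists_solution (hα : 0 ≤ α) (P : Fin n → Prop) [DecidablePred P] {r B : ℝ} (hr : 0 < r)
    (hB0 : 0 ≤ B) (hc : S.Contractive α P r B) {Z U : Set ℂ} (hU : IsOpen U) (hUZ : U ⊆ Z)
    (hZ : ∀ z ∈ Z, r ≤ ‖z‖) {μ : ℂ → ℝ} (hμ : ∀ z, |μ z| ≤ ‖z‖)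
    (hP : ∀ z ∈ Z, ∀ j, P j → (z * S.b j).re ≤ μ z)
    (hN : ∀ z ∈ Z, ∀ j, ¬ P j → μ z ≤ (z * S.b j).re) {k : Fin n} (hk : P k) :
    ∃ u : ℝ → ℂ → Fin n → ℂ,
      (∀ z ∈ Z, IsSolution S.ρ S.b S.A S.C z (fun x => u x z)) ∧
      (∀ z ∈ Z, ∀ x j, α ≤ x →
        ‖u x z j‖ ≤ 8 * S.D * (1 + B) * Real.exp (μ z * (S.p x - S.p α))) ∧
      (∀ x j, ContinuousOn (fun z => u x z j) Z) ∧
      (∀ x j, DifferentiableOn ℂ (fun z => u x z j) U) ∧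
      ∀ z ∈ Z, ∀ j, P j → u α z j = if j = k then 1 else 0 := by
  have hZ0 : Z ⊆ {0}ᶜ := fun z hz h0 => by
    have := hZ z hz
    rw [mem_singleton_iff.1 h0, norm_zero] at this
    linarith
  obtain ⟨v, hvm, hvb, hv, hvZ, hvU⟩ :=
    S.exists_forward hα P hr hB0 hc hU hUZ hZ hμ hP hN hk
  obtain ⟨y, hyi, hy, hyZ, hyU⟩ := S.exists_backward (α := α) hU hUZ hZ0
    (c := fun z j => v z α j) (fun j => hvZ α j) (fun j => hvU α j)
  set u : ℝ → ℂ → Fin n → ℂ := fun x z j => if α ≤ x then v z x j else y z x j with hu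
  have hu1 : ∀ x z j, α ≤ x → u x z j = v z x j := fun x z j h => if_pos h
  have hu2 : ∀ x z j, x < α → u x z j = y z x j := fun x z j h => if_neg (not_le.2 h)
  have hs1 : ∀ z j t, α ≤ t → S.src z (fun x => u x z) j t = S.src z (v z) j t := by
    intro z j t ht
    simp only [src, hu1 t z _ ht]
  have hs2 : ∀ z j t, t < α → S.src z (fun x => u x z) j t = S.src z (y z) j t := by
    intro z j t ht
    simp only [src, hu2 t z _ ht]
  have hi1 : ∀ z j x, α ≤ x →
      ∫ t in α..x, S.src z (fun x => u x z) j t = ∫ t in α..x, S.src z (v z) j t := by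
    intro z j x hx
    refine intervalIntegral.integral_congr fun t ht => ?_
    rw [uIcc_of_le hx] at ht
    exact hs1 z j t ht.1
  have hae : ∀ᵐ t : ℝ, t ≠ α := by simp [ae_iff, measure_singleton]
  have hi2 : ∀ z j x, x ≤ α →
      ∫ t in α..x, S.src z (fun x => u x z) j t = ∫ t in α..x, S.src z (y z) j t := by
    intro z j x hx
    refine intervalIntegral.integral_congr_ae ?_
    filter_upwards [hae] with t ht htm
    rw [uIoc_of_ge hx] at htm
    exact hs2 z j t (lt_of_le_of_ne htm.2 ht)
  refine ⟨u, fun z hz => ?_, fun z hz x j hx => ?_, fun x j => ?_, fun x j => ?_,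
    fun z hz j hj => ?_⟩
  -- The constant `exp(-θ_j(α)) v_j(α)` is common to both pieces, so one representation holds on the
  -- whole half-line and no smoothness check at `α` is needed.
  · refine S.isSolution_of_eq hα (κ := fun j => Complex.exp (-S.θ j z α) * v z α j) ?_ ?_
    · intro T j hT
      have h1 : IntervalIntegrable (S.src z (fun x => u x z) j) volume 0 α := by
        rw [intervalIntegrable_iff_integrableOn_Ioc_of_le hα]
        refine (hyi z hz j).congr ?_
        filter_upwards [ae_restrict_of_ae hae, ae_restrict_mem measurableSet_Ioc] with t ht htm
        exact (hs2 z j t (lt_of_le_of_ne htm.2 ht)).symm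
      have h2 : IntervalIntegrable (S.src z (fun x => u x z) j) volume α (max T α) := by
        rw [intervalIntegrable_iff_integrableOn_Ioc_of_le (le_max_right _ _)]
        refine (S.integrableOn_Ioc_src (z := z) hα (hvm z hz) (hvb z hz) j (max T α)).congr ?_
        filter_upwards [ae_restrict_mem measurableSet_Ioc] with t htm
        exact (hs1 z j t htm.1.le).symm
      refine (h1.trans h2).mono_set ?_
      rw [uIcc_of_le hT, uIcc_of_le (le_max_of_le_left hT)]
      exact Icc_subset_Icc_right (le_max_left _ _)
    · intro x j hx
      by_cases hxα : α ≤ x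
      · obtain ⟨κ, -, hκ⟩ := hv z hz j
        have h3 : Complex.exp (-S.θ j z α) * v z α j = κ := by
          rw [hκ α le_rfl, intervalIntegral.integral_same, add_zero, ← mul_assoc,
            ← Complex.exp_add, neg_add_cancel, Complex.exp_zero, one_mul]
        rw [hu1 x z j hxα, hi1 z j x hxα, h3]
        exact hκ x hxα
      · rw [hu2 x z j (not_le.1 hxα), hi2 z j x (not_le.1 hxα).le]
        exact hy z hz j x ⟨hx, (not_le.1 hxα).le⟩
  · rw [hu1 x z j hx]
    have := hvb z hz x j
    rwa [wt, if_pos hx] at this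
  · by_cases hx : α ≤ x
    · simpa only [hu1 x _ j hx] using hvZ x j
    · simpa only [hu2 x _ j (not_le.1 hx)] using hyZ x j
  · by_cases hx : α ≤ x
    · simpa only [hu1 x _ j hx] using hvU x j
    · simpa only [hu2 x _ j (not_le.1 hx)] using hyU x j
  · obtain ⟨κ, hκ0, hκ⟩ := hv z hz j
    rw [hu1 α z j le_rfl, hκ α le_rfl, intervalIntegral.integral_same, add_zero, hκ0 hj]
    split_ifs with h
    · rw [h, ← Complex.exp_add, add_neg_cancel, Complex.exp_zero]
    · rw [mul_zero]

end System

/-! ### Roots of unity and the order of `Re(z b_j)` in the sectors -/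

section Sectors

variable {n m : ℕ}

/-- The argument of `rootOfUnity n j` in units of `π / n`. -/
noncomputable def rootArg (j : ℕ) : ℝ := if Odd j then (j : ℝ) - 1 else -(j : ℝ)

theorem rootArg_odd (s : ℕ) : rootArg (2 * s + 1) = 2 * s := by
  simp [rootArg]

theorem rootArg_even (s : ℕ) : rootArg (s + s) = -(2 * s) := by
  have : ¬ Odd (s + s) := by
    rw [Nat.not_odd_iff_even]
    exact ⟨s, rfl⟩
  rw [rootArg, if_neg this]
  push_cast
  ring

theorem rootOfUnity_eq (n j : ℕ) :
    rootOfUnity n j = Complex.exp ((Real.pi / n * rootArg j : ℝ) * Complex.I) := by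
  unfold rootOfUnity
  rcases Nat.even_or_odd j with ⟨s, rfl⟩ | ⟨s, rfl⟩
  · rw [if_neg (by rw [Nat.not_odd_iff_even]; exact ⟨s, rfl⟩), rootArg_even,
      show (s + s) / 2 = s by omega]
    push_cast
    congr 1
    ring
  · rw [if_pos ⟨s, rfl⟩, rootArg_odd, show (2 * s + 1) / 2 = s by omega]
    push_cast
    congr 1
    ring

theorem norm_rootOfUnity (n j : ℕ) : ‖rootOfUnity n j‖ = 1 := by
  rw [rootOfUnity_eq, Complex.norm_exp_ofReal_mul_I]

/-- In units of `π / n` the arguments are integers whose differences are less than `2n` in absolute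
value, so equality modulo a full turn is equality; parity then recovers the index. -/
theorem rootOfUnity_injective (n : ℕ) :
    Function.Injective fun j : Fin n => rootOfUnity n ((j : ℕ) + 1) := by
  intro j k h
  have hn : 0 < n := j.pos
  have hn' : (0 : ℝ) < n := by exact_mod_cast hn
  simp only [rootOfUnity_eq] at h
  rw [Complex.exp_eq_exp_iff_exists_int] at h
  obtain ⟨N, hN⟩ := h
  have h1 : rootArg ((j : ℕ) + 1) = rootArg ((k : ℕ) + 1) + 2 * n * N := by
    have h2 : Real.pi / n * rootArg ((j : ℕ) + 1) =
        Real.pi / n * rootArg ((k : ℕ) + 1) + N * (2 * Real.pi) := by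
      have h3 := congrArg Complex.im hN
      simpa using h3
    have hpi := Real.pi_pos
    field_simp at h2
    linarith
  have hj := j.isLt
  have hk := k.isLt
  apply Fin.ext
  have h2 : ∀ a b : ℤ, (a : ℝ) = b + 2 * n * N → a = b + 2 * n * N := fun a b h => by
    exact_mod_cast h
  have h3 : ∀ a b : ℤ, a = b + 2 * n * N → a - b < 2 * n → b - a < 2 * n → a = b := by
    intro a b h ha hb
    have hN : N = 0 := by
      have hN1 : N < 1 := by
        by_contra h'
        nlinarith
      have hN2 : -1 < N := by
        by_contra h'
        nlinarith
      omega
    simp [h, hN]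
  rcases Nat.even_or_odd ((j : ℕ) + 1) with ⟨s, hs⟩ | ⟨s, hs⟩ <;>
  rcases Nat.even_or_odd ((k : ℕ) + 1) with ⟨t, ht⟩ | ⟨t, ht⟩ <;>
  rw [hs, ht] at h1 <;>
  simp only [rootArg_even, rootArg_odd] at h1
  · have := h3 _ _ (h2 (-(2 * s)) (-(2 * t)) (by push_cast; exact h1)) (by omega) (by omega)
    omega
  · have := h3 _ _ (h2 (-(2 * s)) (2 * t) (by push_cast; exact h1)) (by omega) (by omega)
    omega
  · have := h3 _ _ (h2 (2 * s) (-(2 * t)) (by push_cast; exact h1)) (by omega) (by omega)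
    omega
  · have := h3 _ _ (h2 (2 * s) (2 * t) (by push_cast; exact h1)) (by omega) (by omega)
    omega

/-- Cosine is even and decreasing on `[0, π]`. If `|B| > π`, reflection replaces it by `2π - |B|`,
which is still at least `|A|` by the second condition. -/
theorem cos_le_cos_of_abs {A B : ℝ} (h1 : |A| ≤ |B|) (h2 : |A| + |B| ≤ 2 * Real.pi) :
    Real.cos B ≤ Real.cos A := by
  rw [← Real.cos_abs A, ← Real.cos_abs B]
  by_cases h : |B| ≤ Real.pi
  · exact Real.cos_le_cos_of_nonneg_of_le_pi (abs_nonneg _) h h1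
  · rw [← Real.cos_two_pi_sub |B|]
    exact Real.cos_le_cos_of_nonneg_of_le_pi (abs_nonneg _) (by linarith) (by linarith)

/-- Here `Re(z b_i) = r cos(π (τ + rootArg i) / n)`, so comparing real parts reduces to comparing
distances `|τ + rootArg i|`. -/
theorem re_mul_rootOfUnity_le {r τ : ℝ} (hn : 0 < n) (hr : 0 ≤ r) {j k : ℕ}
    (h1 : |τ + rootArg j| ≤ |τ + rootArg k|)
    (h2 : |τ + rootArg j| + |τ + rootArg k| ≤ 2 * n) :
    (r * Complex.exp ((Real.pi / n * τ : ℝ) * Complex.I) * rootOfUnity n k).re ≤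
      (r * Complex.exp ((Real.pi / n * τ : ℝ) * Complex.I) * rootOfUnity n j).re := by
  have hn' : (0 : ℝ) < n := by exact_mod_cast hn
  have h3 : ∀ i, (r * Complex.exp ((Real.pi / n * τ : ℝ) * Complex.I) * rootOfUnity n i).re =
      r * Real.cos (Real.pi / n * (τ + rootArg i)) := by
    intro i
    rw [rootOfUnity_eq, mul_assoc, ← Complex.exp_add, ← add_mul, ← Complex.ofReal_add,
      Complex.re_ofReal_mul, Complex.exp_ofReal_mul_I_re, mul_add]
  rw [h3, h3]
  have hpn : 0 < Real.pi / n := div_pos Real.pi_pos hn'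
  refine mul_le_mul_of_nonneg_left (cos_le_cos_of_abs ?_ ?_) hr
  · rw [abs_mul, abs_mul]
    exact mul_le_mul_of_nonneg_left h1 (abs_nonneg _)
  · rw [abs_mul, abs_mul, ← mul_add, abs_of_pos hpn]
    calc _ ≤ Real.pi / n * (2 * n) := mul_le_mul_of_nonneg_left h2 hpn.le
      _ = 2 * Real.pi := by
        field_simp

theorem exists_of_mem_sector {β₁ β₂ a b : ℝ} (hn : 0 < n) (h1 : β₁ = Real.pi / n * a)
    (h2 : β₂ = Real.pi / n * b) {z : ℂ} (hz : z ∈ sector β₁ β₂) :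
    ∃ r τ : ℝ, 0 < r ∧ a < τ ∧ τ < b ∧
      z = r * Complex.exp ((Real.pi / n * τ : ℝ) * Complex.I) := by
  obtain ⟨r, t, hr, ht1, ht2, rfl⟩ := hz
  have hn' : (0 : ℝ) < n := by exact_mod_cast hn
  have hpn : 0 < Real.pi / n := div_pos Real.pi_pos hn'
  have e : Real.pi / n * (t / (Real.pi / n)) = t := by field_simp
  refine ⟨r, t / (Real.pi / n), hr, ?_, ?_, by rw [e]⟩
  · rwa [lt_div_iff₀ hpn, mul_comm, ← h1]
  · rwa [div_lt_iff₀ hpn, mul_comm, ← h2]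

theorem mem_sector_of_eq {β₁ β₂ a b r τ : ℝ} (hn : 0 < n) (h1 : β₁ = Real.pi / n * a)
    (h2 : β₂ = Real.pi / n * b) (hr : 0 < r) (ha : a < τ) (hb : τ < b) :
    (r * Complex.exp ((Real.pi / n * τ : ℝ) * Complex.I) : ℂ) ∈ sector β₁ β₂ := by
  have hn' : (0 : ℝ) < n := by exact_mod_cast hn
  have hpn : 0 < Real.pi / n := div_pos Real.pi_pos hn'
  exact ⟨r, _, hr, h1 ▸ mul_lt_mul_of_pos_left ha hpn, h2 ▸ mul_lt_mul_of_pos_left hb hpn, rfl⟩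

/-- The lower end of the range of the argument in `Om n m` in units of `π / n`. -/
noncomputable def omArg (m : ℕ) : ℝ := if Even m then -1 else 0

theorem om_bounds (hm : 2 ≤ m) :
    ((-1 : ℝ) ^ (m - 1) - 1) * Real.pi / (2 * n) = Real.pi / n * omArg m ∧
    ((-1 : ℝ) ^ (m - 1) + 3) * Real.pi / (2 * n) = Real.pi / n * (omArg m + 2) := by
  unfold omArg
  by_cases h : Even m
  · have h1 : Odd (m - 1) := Nat.Even.sub_odd (by omega) h odd_one
    rw [h1.neg_one_pow, if_pos h]
    constructor <;> ring
  · have h1 : Even (m - 1) := Nat.Odd.sub_odd (Nat.not_even_iff_odd.1 h) odd_one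
    rw [h1.neg_one_pow, if_neg h]
    constructor <;> ring

theorem exists_of_mem_Om (hn : 0 < n) (hm : 2 ≤ m) {z : ℂ} (hz : z ∈ Om n m) :
    ∃ r τ : ℝ, 0 < r ∧ omArg m < τ ∧ τ < omArg m + 2 ∧
      z = r * Complex.exp ((Real.pi / n * τ : ℝ) * Complex.I) :=
  exists_of_mem_sector hn (om_bounds hm).1 (om_bounds hm).2 hz

theorem exists_of_mem_Gam_one (hn : 0 < n) {z : ℂ} (hz : z ∈ Gam n 1) :
    ∃ r τ : ℝ, 0 < r ∧ 0 < τ ∧ τ < 1 ∧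
      z = r * Complex.exp ((Real.pi / n * τ : ℝ) * Complex.I) :=
  exists_of_mem_sector hn (by simp) (by simp) hz

theorem exists_of_mem_Gam_sig (hn : 0 < n) {z : ℂ} (hz : z ∈ Gam n (sig n m)) :
    ∃ r τ : ℝ, 0 < r ∧ (if Even m then -1 else 1) < τ ∧ τ < (if Even m then 0 else 2) ∧
      z = r * Complex.exp ((Real.pi / n * τ : ℝ) * Complex.I) := by
  have hn' : (0 : ℝ) < n := by exact_mod_cast hn
  unfold Gam sig at hz
  by_cases h : Even m
  · rw [if_pos h] at hz
    obtain ⟨r, τ, hr, h1, h2, rfl⟩ := exists_of_mem_sector (a := 2 * n - 1) (b := 2 * n) hn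
      (by push_cast; ring) (by push_cast; ring) hz
    -- For even `m` the sector is `Γ_{2n}`; subtracting a full turn, `2n` units, places it next to
    -- `Γ_1`.
    refine ⟨r, τ - 2 * n, hr, ?_, ?_, ?_⟩
    · rw [if_pos h]
      linarith
    · rw [if_pos h]
      linarith
    · have e : ((Real.pi / n * τ : ℝ) : ℂ) * Complex.I =
          ((Real.pi / n * (τ - 2 * n) : ℝ) : ℂ) * Complex.I + 2 * Real.pi * Complex.I := by
        have : Real.pi / n * τ = Real.pi / n * (τ - 2 * n) + 2 * Real.pi := by
          field_simp
          ring
        rw [this]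
        push_cast
        ring
      rw [e, Complex.exp_periodic]
  · simp only [if_neg h] at hz ⊢
    exact exists_of_mem_sector hn (by push_cast; ring) (by push_cast; ring) hz

theorem Gam_one_subset_Om (hn : 0 < n) (hm : 2 ≤ m) : Gam n 1 ⊆ Om n m := by
  intro z hz
  obtain ⟨r, τ, hr, h1, h2, rfl⟩ := exists_of_mem_Gam_one hn hz
  refine mem_sector_of_eq hn (om_bounds hm).1 (om_bounds hm).2 hr ?_ ?_ <;>
  · unfold omArg
    split_ifs <;> linarith

theorem Gam_sig_subset_Om (hn : 0 < n) (hm : 2 ≤ m) : Gam n (sig n m) ⊆ Om n m := by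
  intro z hz
  obtain ⟨r, τ, hr, h1, h2, rfl⟩ := exists_of_mem_Gam_sig hn hz
  refine mem_sector_of_eq hn (om_bounds hm).1 (om_bounds hm).2 hr ?_ ?_ <;>
  · unfold omArg
    split_ifs at h1 h2 ⊢ <;> linarith

theorem omArg_even (q : ℕ) : omArg (q + q) = -1 := if_pos ⟨q, rfl⟩

theorem omArg_odd (q : ℕ) : omArg (2 * q + 1) = 0 :=
  if_neg (by rw [Nat.not_even_iff_odd]; exact ⟨q, rfl⟩)

/-- The number `m - 1` is the threshold separating the two groups throughout `Ω_m`: indices below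
`m` lie on one side of it, the others on the opposite side by `le_abs_add_rootArg`. -/
theorem abs_add_rootArg_le {j : ℕ} {τ : ℝ} (hj : 1 ≤ j) (hjm : j < m) (h1 : omArg m < τ)
    (h2 : τ < omArg m + 2) : |τ + rootArg j| ≤ m - 1 := by
  rw [abs_le]
  rcases Nat.even_or_odd j with ⟨s, rfl⟩ | ⟨s, rfl⟩ <;>
  rcases Nat.even_or_odd m with ⟨q, rfl⟩ | ⟨q, rfl⟩ <;>
  simp only [omArg_even, omArg_odd, rootArg_even, rootArg_odd] at h1 h2 ⊢ <;>
  push_cast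
  · have h : (s : ℝ) + 1 ≤ q := by exact_mod_cast (by omega : s + 1 ≤ q)
    constructor <;> linarith
  · have h : (s : ℝ) ≤ q := by exact_mod_cast (by omega : s ≤ q)
    have h' : (1 : ℝ) ≤ s := by exact_mod_cast (by omega : 1 ≤ s)
    constructor <;> linarith
  · have h : (s : ℝ) + 1 ≤ q := by exact_mod_cast (by omega : s + 1 ≤ q)
    constructor <;> linarith
  · have h : (s : ℝ) + 1 ≤ q := by exact_mod_cast (by omega : s + 1 ≤ q)
    constructor <;> linarith

theorem le_abs_add_rootArg {k : ℕ} {τ : ℝ} (hm : 2 ≤ m) (hmk : m ≤ k) (h1 : omArg m < τ)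
    (h2 : τ < omArg m + 2) : (m : ℝ) - 1 ≤ |τ + rootArg k| ∧ |τ + rootArg k| ≤ k + 1 := by
  rw [le_abs, abs_le]
  rcases Nat.even_or_odd k with ⟨s, rfl⟩ | ⟨s, rfl⟩ <;>
  rcases Nat.even_or_odd m with ⟨q, rfl⟩ | ⟨q, rfl⟩ <;>
  simp only [omArg_even, omArg_odd, rootArg_even, rootArg_odd] at h1 h2 ⊢ <;>
  push_cast
  · have h : (q : ℝ) ≤ s := by exact_mod_cast (by omega : q ≤ s)
    refine ⟨Or.inr ?_, ?_, ?_⟩ <;> linarith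
  · have h : (q : ℝ) + 1 ≤ s := by exact_mod_cast (by omega : q + 1 ≤ s)
    refine ⟨Or.inr ?_, ?_, ?_⟩ <;> linarith
  · have h : (q : ℝ) ≤ s := by exact_mod_cast (by omega : q ≤ s)
    refine ⟨Or.inl ?_, ?_, ?_⟩ <;> linarith
  · have h : (q : ℝ) ≤ s := by exact_mod_cast (by omega : q ≤ s)
    refine ⟨Or.inl ?_, ?_, ?_⟩ <;> linarith

theorem re_le_re_of_mem_Om (hm : 2 ≤ m) {j k : ℕ} (hj : 1 ≤ j) (hjm : j < m) (hmk : m ≤ k)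
    (hkn : k ≤ n) {z : ℂ} (hz : z ∈ Om n m) :
    (z * rootOfUnity n k).re ≤ (z * rootOfUnity n j).re := by
  have hn : 0 < n := by omega
  obtain ⟨r, τ, hr, h1, h2, rfl⟩ := exists_of_mem_Om hn hm hz
  have h3 := abs_add_rootArg_le hj hjm h1 h2
  obtain ⟨h4, h5⟩ := le_abs_add_rootArg hm hmk h1 h2
  have hkn' : (k : ℝ) ≤ n := by exact_mod_cast hkn
  have hmk' : (m : ℝ) ≤ k := by exact_mod_cast hmk
  exact re_mul_rootOfUnity_le hn hr.le (h3.trans h4) (by linarith)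

/-- For `0 < τ < 1` the distance `|τ + rootArg i|` lies between `i - 1` and `i`, so in `Γ_1` the
real parts are ordered by the index. -/
theorem re_le_re_of_mem_Gam_one {j k : ℕ} (hj : 1 ≤ j) (hjk : j ≤ k) (hkn : k ≤ n) {z : ℂ}
    (hz : z ∈ Gam n 1) : (z * rootOfUnity n k).re ≤ (z * rootOfUnity n j).re := by
  have hn : 0 < n := by omega
  obtain ⟨r, τ, hr, h1, h2, rfl⟩ := exists_of_mem_Gam_one hn hz
  have habs : ∀ i : ℕ, 1 ≤ i → |τ + rootArg i| = if Odd i then i - 1 + τ else i - τ := by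
    intro i hi
    have hi' : (1 : ℝ) ≤ i := by exact_mod_cast hi
    unfold rootArg
    split_ifs
    · rw [abs_of_nonneg (by linarith)]
      ring
    · rw [abs_of_nonpos (by linarith)]
      ring
  have hkn' : (k : ℝ) ≤ n := by exact_mod_cast hkn
  have hjk' : (j : ℝ) ≤ k := by exact_mod_cast hjk
  have hlt : ¬ (Odd j ↔ Odd k) → (j : ℝ) + 1 ≤ k := by
    intro h
    have : j ≠ k := by
      rintro rfl
      exact h Iff.rfl
    exact_mod_cast (by omega : j + 1 ≤ k)
  refine re_mul_rootOfUnity_le hn hr.le ?_ ?_ <;>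
  · rw [habs j hj, habs k (hj.trans hjk)]
    split_ifs with h3 h4 h4
    · linarith
    · have := hlt (by tauto)
      linarith
    · have := hlt (by tauto)
      linarith
    · linarith

/-- In the neighbouring sector the distances for `m` and `m + 1` are interchanged: that of `m + 1`
lies between `m - 1` and `m`, that of `m` between `m` and `m + 1`. For `m = n` only `b_n` remains.
-/
theorem re_le_re_of_mem_Gam_sig (hm : 2 ≤ m) {k : ℕ} (hmk : m ≤ k) (hkn : k ≤ n) {z : ℂ}
    (hz : z ∈ Gam n (sig n m)) :
    (z * rootOfUnity n k).re ≤ (z * rootOfUnity n (min (m + 1) n)).re := by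
  have hn : 0 < n := by omega
  rcases (hmk.trans hkn).eq_or_lt with rfl | hlt
  · rw [show k = m by omega, min_eq_right (by omega)]
  rw [min_eq_left hlt]
  obtain ⟨r, τ, hr, h1, h2, rfl⟩ := exists_of_mem_Gam_sig hn hz
  have key : |τ + rootArg (m + 1)| ≤ |τ + rootArg k| ∧
      |τ + rootArg (m + 1)| + |τ + rootArg k| ≤ k + m := by
    rcases Nat.even_or_odd m with ⟨q, rfl⟩ | ⟨q, rfl⟩
    · have h3 : Even (q + q) := ⟨q, rfl⟩
      rw [if_pos h3] at h1 h2
      have hq : (1 : ℝ) ≤ q := by exact_mod_cast (by omega : 1 ≤ q)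
      rw [show q + q + 1 = 2 * q + 1 by ring, rootArg_odd, abs_of_nonneg (by linarith)]
      rcases Nat.even_or_odd k with ⟨s, rfl⟩ | ⟨s, rfl⟩
      · have hs : (q : ℝ) ≤ s := by exact_mod_cast (by omega : q ≤ s)
        rw [rootArg_even, abs_of_nonpos (by linarith)]
        push_cast
        constructor <;> linarith
      · have hs : (q : ℝ) ≤ s := by exact_mod_cast (by omega : q ≤ s)
        rw [rootArg_odd, abs_of_nonneg (by linarith)]
        push_cast
        constructor <;> linarith
    · have h3 : ¬ Even (2 * q + 1) := by
        rw [Nat.not_even_iff_odd]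
        exact ⟨q, rfl⟩
      rw [if_neg h3] at h1 h2
      have hq : (1 : ℝ) ≤ q := by exact_mod_cast (by omega : 1 ≤ q)
      rw [show 2 * q + 1 + 1 = (q + 1) + (q + 1) by ring, rootArg_even]
      push_cast
      rw [abs_of_nonpos (a := τ + -(2 * ((q : ℝ) + 1))) (by linarith)]
      rcases Nat.even_or_odd k with ⟨s, rfl⟩ | ⟨s, rfl⟩
      · have hs : (q : ℝ) + 1 ≤ s := by exact_mod_cast (by omega : q + 1 ≤ s)
        rw [rootArg_even, abs_of_nonpos (by linarith)]
        push_cast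
        constructor <;> linarith
      · have hs : (q : ℝ) ≤ s := by exact_mod_cast (by omega : q ≤ s)
        rw [rootArg_odd, abs_of_nonneg (by linarith)]
        push_cast
        constructor <;> linarith
  have h3 : (k : ℝ) + m ≤ 2 * n := by exact_mod_cast (by omega : k + m ≤ 2 * n)
  exact re_mul_rootOfUnity_le hn hr.le key.1 (key.2.trans h3)

/-- The sector is the image of a horizontal strip under the exponential, which is an open map. -/
theorem isOpen_sector (β₁ β₂ : ℝ) : IsOpen (sector β₁ β₂) := by
  have h : sector β₁ β₂ = Complex.exp '' {w : ℂ | β₁ < w.im ∧ w.im < β₂} := by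
    ext z
    constructor
    · rintro ⟨r, t, hr, h1, h2, rfl⟩
      refine ⟨Real.log r + t * Complex.I, by simpa using ⟨h1, h2⟩, ?_⟩
      rw [Complex.exp_add, ← Complex.ofReal_exp, Real.exp_log hr]
    · rintro ⟨w, ⟨h1, h2⟩, rfl⟩
      refine ⟨Real.exp w.re, w.im, Real.exp_pos _, h1, h2, ?_⟩
      rw [Complex.ofReal_exp, ← Complex.exp_add, Complex.re_add_im]
  rw [h]
  exact Complex.isOpenMap_exp _ ((isOpen_lt continuous_const Complex.continuous_im).inter
    (isOpen_lt Complex.continuous_im continuous_const))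

theorem outer_mono {S T : Set ℂ} (h : S ⊆ T) (r : ℝ) : outer S r ⊆ outer T r :=
  fun _ hw => ⟨h hw.1, hw.2⟩

theorem isOpen_outer {S : Set ℂ} (hS : IsOpen S) (r : ℝ) : IsOpen (outer S r) :=
  hS.inter (isOpen_lt continuous_const continuous_norm)

theorem le_norm_of_mem_closure_outer {S : Set ℂ} {r : ℝ} {z : ℂ} (hz : z ∈ closure (outer S r)) :
    r ≤ ‖z‖ :=
  closure_minimal (fun _ h => h.2.le) (isClosed_le continuous_const continuous_norm) hz

theorem re_le_re_of_mem_closure_outer {S : Set ℂ} {r : ℝ} {a b : ℂ}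
    (h : ∀ z ∈ S, (z * a).re ≤ (z * b).re) {z : ℂ} (hz : z ∈ closure (outer S r)) :
    (z * a).re ≤ (z * b).re :=
  closure_minimal (fun w hw => h w hw.1)
    (isClosed_le (Complex.continuous_re.comp (continuous_id.mul continuous_const))
      (Complex.continuous_re.comp (continuous_id.mul continuous_const))) hz

end Sectors

/-! ### Large `α` under the tail condition -/

namespace System

variable {n : ℕ} (S : System n)

/-- Under the condition on the tails, the operator is a contraction for large `α` and
`φ(α) ≤ |z|`. -/
theorem eventually_contractive (P : Fin n → Prop) [DecidablePred P] {φ : ℝ → ℝ}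
    (hφ : Tendsto (fun α => ⨆ z : {z : ℂ // φ α ≤ ‖z‖}, tailNorm S.C α z) atTop (𝓝 0)) :
    ∀ᶠ α in atTop, S.Contractive α P (φ α) (1 / 2) := by
  have hD := S.D_pos
  -- With `β = (n + 1) δ` this gives `D β = 1/4`.
  set δ : ℝ := 1 / (4 * S.D * (n + 1)) with hδ
  have hδ0 : 0 < δ := by positivity
  have h1 : Tendsto (fun α : ℝ => ∑ j, ∑ l, ∫ t in Ici α, ‖S.A t j l‖) atTop (𝓝 0) := by
    have : ∀ j l, Tendsto (fun α : ℝ => ∫ t in Ici α, ‖S.A t j l‖) atTop (𝓝 0) := by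
      intro j l
      simp only [integral_Ici_eq_integral_Ioi]
      exact tendsto_integral_Ioi_zero tendsto_id
    simpa using tendsto_finsetSum Finset.univ fun j _ =>
      tendsto_finsetSum Finset.univ fun l _ => this j l
  have h2 : ∀ᶠ α : ℝ in atTop, ∑ j, ∑ l, ∫ t in Ici α, ‖S.A t j l‖ ≤ δ :=
    h1.eventually (eventually_le_nhds hδ0)
  have h3 := hφ.eventually (eventually_le_nhds (ENNReal.ofReal_pos.2 hδ0))
  filter_upwards [h2, h3, eventually_ge_atTop 0] with α hα2 hα3 hα0
  refine S.contractive_of_small hα0 (β := δ + n * δ) ?_ fun z hz j => ?_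
  · have hn : (0 : ℝ) ≤ n := n.cast_nonneg
    rw [hδ]
    field_simp
    linarith
  · refine (S.sum_integral_norm_Q_le hα0 z j (γ := δ) fun j l => ?_).trans
      (add_le_add_left hα2 _)
    have hm : AEStronglyMeasurable (S.C z j l) (volume.restrict (Ici α)) :=
      (Lp.stronglyMeasurable _).aestronglyMeasurable
    rw [integral_norm_eq_lintegral_enorm hm]
    refine ENNReal.toReal_le_of_le_ofReal hδ0.le (le_trans ?_ hα3)
    refine le_trans ?_ (le_iSup (fun z : {z : ℂ // φ α ≤ ‖z‖} => tailNorm S.C α z) ⟨z, hz⟩)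
    exact le_iSup₂_of_le j l le_rfl

end System

/-! ### Assembly -/

/-- The conclusion of the main theorem for fixed `α` and a fixed bound `r` for the parameter. -/
def HasSystem {n : ℕ} (m : ℕ) (ρ : ℝ → ℝ) (A : ℝ → Matrix (Fin n) (Fin n) ℂ)
    (C : ℂ → Matrix (Fin n) (Fin n) L1HalfLine) (α r : ℝ) : Prop :=
  ∃ u : ℝ → ℂ → Matrix (Fin n) {k : Fin n // m ≤ (k : ℕ) + 1} ℂ,
    (∀ z ∈ closure (outer (Om n m) r), ∀ k,
      IsSolution ρ (fun j => rootOfUnity n ((j : ℕ) + 1)) A C z (fun x j => u x z j k)) ∧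
    (∃ N : ℝ, ∀ j k, ∀ x : ℝ, α ≤ x →
      (∀ z ∈ closure (outer (Gam n 1) r),
        ‖u x z j k‖ ≤ N * ‖Complex.exp (z * rootOfUnity n m *
          ((primitive ρ x - primitive ρ α : ℝ) : ℂ))‖) ∧
      (∀ z ∈ closure (outer (Gam n (sig n m)) r),
        ‖u x z j k‖ ≤ N * ‖Complex.exp (z * rootOfUnity n (min (m + 1) n) *
          ((primitive ρ x - primitive ρ α : ℝ) : ℂ))‖)) ∧
    (∀ x : ℝ, 0 ≤ x → ∀ j k,
      ContinuousOn (fun z => u x z j k) (closure (outer (Om n m) r)) ∧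
      AnalyticOnNhd ℂ (fun z => u x z j k) (outer (Om n m) r)) ∧
    (∀ z ∈ closure (outer (Om n m) r), ∀ (j : Fin n) (k : {k : Fin n // m ≤ (k : ℕ) + 1}),
      m ≤ (j : ℕ) + 1 → u α z j k = if j = (k : Fin n) then 1 else 0)

theorem System.hasSystem {n m : ℕ} (hm : 2 ≤ m) (hmn : m ≤ n) (S : System n)
    (hb : S.b = fun j : Fin n => rootOfUnity n ((j : ℕ) + 1)) {α r B : ℝ} (hα : 0 ≤ α) (hr : 0 < r)
    (hB0 : 0 ≤ B) (hc : S.Contractive α (fun j => m ≤ (j : ℕ) + 1) r B) :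
    HasSystem m S.ρ S.A S.C α r := by
  have hbj : ∀ j : Fin n, S.b j = rootOfUnity n ((j : ℕ) + 1) := fun j => congrFun hb j
  have hn : 0 < n := by omega
  set I : Finset (Fin n) := Finset.univ.filter fun j : Fin n => m ≤ (j : ℕ) + 1 with hI
  have hImem : ∀ j, j ∈ I ↔ m ≤ (j : ℕ) + 1 := fun j => by simp [hI]
  have hIne : I.Nonempty := ⟨⟨n - 1, by omega⟩, (hImem _).2 (by simp only; omega)⟩
  -- Taking the maximum gives one weight for the whole sector; it is bounded by the exponent of
  -- `b_m` or of `b_{m+1}` only after restriction to `Γ_1` or `Γ_σ`.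
  set μ : ℂ → ℝ := fun z => I.sup' hIne fun j => (z * S.b j).re with hμ
  have hμle : ∀ z, |μ z| ≤ ‖z‖ := by
    intro z
    obtain ⟨j, -, hj⟩ := Finset.exists_mem_eq_sup' hIne fun j => (z * S.b j).re
    simp only [hμ]
    rw [hj]
    refine (Complex.abs_re_le_norm _).trans ?_
    rw [norm_mul]
    exact mul_le_of_le_one_right (norm_nonneg _) (S.norm_b j)
  have hP : ∀ z ∈ closure (outer (Om n m) r), ∀ j : Fin n, m ≤ (j : ℕ) + 1 →
      (z * S.b j).re ≤ μ z := fun z _ j hj =>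
    Finset.le_sup' (fun j => (z * S.b j).re) ((hImem j).2 hj)
  have hN : ∀ z ∈ closure (outer (Om n m) r), ∀ j : Fin n, ¬ m ≤ (j : ℕ) + 1 →
      μ z ≤ (z * S.b j).re := by
    intro z hz j hj
    refine Finset.sup'_le _ _ fun k hk => ?_
    rw [hbj, hbj]
    exact re_le_re_of_mem_closure_outer (fun w hw => re_le_re_of_mem_Om hm (by omega)
      (not_le.1 hj) ((hImem k).1 hk) (by have := k.isLt; omega) hw) hz
  have hU : IsOpen (outer (Om n m) r) := isOpen_outer (isOpen_sector _ _) r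
  have hsol := fun k : {k : Fin n // m ≤ (k : ℕ) + 1} =>
    S.exists_solution hα (fun j => m ≤ (j : ℕ) + 1) hr hB0 hc hU subset_closure
      (fun z hz => le_norm_of_mem_closure_outer hz) hμle hP hN k.2
  choose v hv1 hv2 hv3 hv4 hv5 using hsol
  have hexp : ∀ (j : Fin n) k x, α ≤ x → ∀ z ∈ closure (outer (Om n m) r), ∀ b : ℂ,
      μ z ≤ (z * b).re → ‖v k x z j‖ ≤ 8 * S.D * (1 + B) *
        ‖Complex.exp (z * b * ((primitive S.ρ x - primitive S.ρ α : ℝ) : ℂ))‖ := by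
    intro j k x hx z hz b hzb
    have hD := S.D_pos
    refine (hv2 k z hz x j hx).trans (mul_le_mul_of_nonneg_left ?_ (by positivity))
    rw [Complex.norm_exp, Complex.re_mul_ofReal]
    exact Real.exp_le_exp.2 (mul_le_mul_of_nonneg_right hzb (sub_nonneg.2 (S.p_mono hα hx)))
  refine ⟨fun x z => Matrix.of fun j k => v k x z j, fun z hz k => ?_,
    ⟨8 * S.D * (1 + B), fun j k x hx => ⟨fun z hz => ?_, fun z hz => ?_⟩⟩,
    fun x _ j k => ⟨hv3 k x j, (hv4 k x j).analyticOnNhd hU⟩,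
    fun z hz j k hj => hv5 k z hz j hj⟩
  · rw [← hb]
    exact hv1 k z hz
  · refine hexp j k x hx z (closure_mono (outer_mono (Gam_one_subset_Om hn hm) r) hz) _
      (Finset.sup'_le _ _ fun i hi => ?_)
    rw [hbj]
    exact re_le_re_of_mem_closure_outer (fun w hw => re_le_re_of_mem_Gam_one (by omega)
      ((hImem i).1 hi) (by have := i.isLt; omega) hw) hz
  · refine hexp j k x hx z (closure_mono (outer_mono (Gam_sig_subset_Om hn hm) r) hz) _
      (Finset.sup'_le _ _ fun i hi => ?_)
    rw [hbj]
    exact re_le_re_of_mem_closure_outer (fun w hw => re_le_re_of_mem_Gam_sig hm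
      ((hImem i).1 hi) (by have := i.isLt; omega) hw) hz

end LargeSector

theorem mainTheorem2 (n m : ℕ) (hm : 2 ≤ m) (hmn : m ≤ n)
    (ρ : ℝ → ℝ) (hρ : ∀ T : ℝ, 0 < T → IntegrableOn ρ (Ico 0 T))
    (hρpos : ∀ᵐ x ∂(volume.restrict (Ici (0 : ℝ))), 0 < ρ x)
    (A : ℝ → Matrix (Fin n) (Fin n) ℂ)
    (hA : ∀ j k, IntegrableOn (fun x => A x j k) (Ici 0))
    (C : ℂ → Matrix (Fin n) (Fin n) LargeSector.L1HalfLine)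
    (hC : ∀ j k, DifferentiableOn ℂ (fun z => C z j k) {0}ᶜ)
    (hC0 : ∀ j k, Tendsto (fun z => ‖C z j k‖) (Bornology.cobounded ℂ) (𝓝 0)) :
    ∃ lam : ℝ → ℝ, (∀ α, 0 ≤ α → 0 < lam α) ∧
      (LargeSector.TailCondition C → Tendsto lam atTop (𝓝 0)) ∧
      ∀ α : ℝ, 0 ≤ α →
        ∃ u : ℝ → ℂ → Matrix (Fin n) {k : Fin n // m ≤ (k : ℕ) + 1} ℂ,
          -- every column is a solution
          (∀ z ∈ closure (LargeSector.outer (LargeSector.Om n m) (lam α)), ∀ k,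
            LargeSector.IsSolution ρ (fun j => LargeSector.rootOfUnity n ((j : ℕ) + 1)) A C z
              (fun x j => u x z j k)) ∧
          -- exponential estimates, uniform in `x ≥ α`; `b_{n+1}` is understood as `b_n`
          (∃ N : ℝ, ∀ j k, ∀ x : ℝ, α ≤ x →
            (∀ z ∈ closure (LargeSector.outer (LargeSector.Gam n 1) (lam α)),
              ‖u x z j k‖ ≤ N * ‖Complex.exp (z * LargeSector.rootOfUnity n m *
                ((LargeSector.primitive ρ x - LargeSector.primitive ρ α : ℝ) : ℂ))‖) ∧
            (∀ z ∈ closure (LargeSector.outer (LargeSector.Gam n (LargeSector.sig n m)) (lam α)),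
              ‖u x z j k‖ ≤ N * ‖Complex.exp (z * LargeSector.rootOfUnity n (min (m + 1) n) *
                ((LargeSector.primitive ρ x - LargeSector.primitive ρ α : ℝ) : ℂ))‖)) ∧
          -- continuity and analyticity in the spectral parameter
          (∀ x : ℝ, 0 ≤ x → ∀ j k,
            ContinuousOn (fun z => u x z j k)
              (closure (LargeSector.outer (LargeSector.Om n m) (lam α))) ∧
            AnalyticOnNhd ℂ (fun z => u x z j k)
              (LargeSector.outer (LargeSector.Om n m) (lam α))) ∧
          -- initial values
          (∀ z ∈ closure (LargeSector.outer (LargeSector.Om n m) (lam α)),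
            ∀ (j : Fin n) (k : {k : Fin n // m ≤ (k : ℕ) + 1}), m ≤ (j : ℕ) + 1 →
              u α z j k = if j = (k : Fin n) then 1 else 0) := by
  classical
  -- The coefficients are extended by zero, so that integrability holds on the whole line; equation
  -- and estimates involve only `x ≥ 0`.
  set ρ₀ : ℝ → ℝ := (Ici (0 : ℝ)).indicator ρ with hρ₀
  set A₀ : ℝ → Matrix (Fin n) (Fin n) ℂ := fun x => if 0 ≤ x then A x else 0 with hA₀
  have hρeq : ∀ x, 0 ≤ x → ρ₀ x = ρ x := fun x hx => indicator_of_mem (mem_Ici.2 hx) ρ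
  have hAeq : ∀ x, 0 ≤ x → A₀ x = A x := fun x hx => if_pos hx
  have hprim : ∀ x, 0 ≤ x → LargeSector.primitive ρ₀ x = LargeSector.primitive ρ x := by
    intro x hx
    refine intervalIntegral.integral_congr fun t ht => ?_
    rw [uIcc_of_le hx] at ht
    exact hρeq t ht.1
  have hloc : LocallyIntegrable ρ₀ := by
    rw [locallyIntegrable_iff]
    intro K hK
    obtain ⟨R, hR⟩ := hK.bddAbove
    rw [hρ₀, integrableOn_indicator_iff measurableSet_Ici]
    refine (hρ (max R 0 + 1) (by positivity)).mono_set fun x hx => ⟨hx.1, ?_⟩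
    have := hR hx.2
    linarith [le_max_left R 0]
  have hAint : ∀ j l, Integrable fun x => A₀ x j l := by
    intro j l
    have : (fun x => A₀ x j l) = (Ici (0 : ℝ)).indicator fun x => A x j l := by
      ext x
      by_cases hx : 0 ≤ x
      · rw [indicator_of_mem (mem_Ici.2 hx), hAeq x hx]
      · rw [indicator_of_notMem (by simpa using hx)]
        simp [hA₀, hx]
    rw [this, integrable_indicator_iff measurableSet_Ici]
    exact hA j l
  set S : LargeSector.System n :=
    { ρ := ρ₀
      b := fun j => LargeSector.rootOfUnity n ((j : ℕ) + 1)
      A := A₀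
      C := C
      locInt := hloc
      pos := by
        filter_upwards [hρpos, ae_restrict_mem measurableSet_Ici] with x hx hx0
        rwa [hρeq x hx0]
      norm_b := fun j => (LargeSector.norm_rootOfUnity _ _).le
      intA := hAint
      diffC := hC } with hS
  have hsys : ∀ α r B : ℝ, 0 ≤ α → 0 < r → 0 ≤ B →
      S.Contractive α (fun j => m ≤ (j : ℕ) + 1) r B → LargeSector.HasSystem m ρ A C α r := by
    intro α r B hα hr hB hc
    obtain ⟨u, hu1, ⟨N, hN⟩, hu3, hu4⟩ := S.hasSystem hm hmn rfl hα hr hB hc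
    refine ⟨u, fun z hz k => ?_, ⟨N, fun j k x hx => ?_⟩, hu3, hu4⟩
    · obtain ⟨h1, h2⟩ := hu1 z hz k
      refine ⟨h1, ?_⟩
      filter_upwards [h2, ae_restrict_mem measurableSet_Ici] with x hx hx0
      have e : LargeSector.coeffMatrix ρ (fun j : Fin n => LargeSector.rootOfUnity n ((j : ℕ) + 1))
          A C z x = LargeSector.coeffMatrix S.ρ
            (fun j : Fin n => LargeSector.rootOfUnity n ((j : ℕ) + 1)) S.A S.C z x := by
        simp only [LargeSector.coeffMatrix, hS, hρeq x hx0, hAeq x hx0]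
      rw [e]
      exact hx
    · rw [← hprim x (hα.trans hx), ← hprim α hα]
      exact hN j k x hx
  have hR : ∀ α : ℝ, ∃ r : ℝ, 0 < r ∧ (0 ≤ α → LargeSector.HasSystem m ρ A C α r) := by
    intro α
    by_cases hα : 0 ≤ α
    · obtain ⟨r, B, hr, hB, hc⟩ := S.exists_contractive hα (fun j => m ≤ (j : ℕ) + 1)
        (LargeSector.rootOfUnity_injective n) hC0
      exact ⟨r, hr, fun _ => hsys α r B hα hr hB hc⟩
    · exact ⟨1, one_pos, fun h => absurd h hα⟩
  choose R hR0 hRs using hR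
  by_cases hT : LargeSector.TailCondition C
  · obtain ⟨φ, hφ0, hφ, hφC⟩ := hT
    -- The radius `φ(α)` is used whenever it is admissible, and the fixed-`α` radius otherwise. The
    -- former holds for all large `α`, so the limit is that of `φ`.
    refine ⟨fun α => if LargeSector.HasSystem m ρ A C α (φ α) then φ α else R α,
      fun α hα => ?_, fun _ => ?_, fun α hα => ?_⟩
    · simp only
      split_ifs
      · exact hφ0 α hα
      · exact hR0 α
    · refine hφ.congr' ?_
      filter_upwards [S.eventually_contractive (fun j => m ≤ (j : ℕ) + 1) hφC,
        eventually_ge_atTop 0] with α hα hα0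
      exact (if_pos (hsys α (φ α) _ hα0 (hφ0 α hα0) (by norm_num) hα)).symm
    · have : LargeSector.HasSystem m ρ A C α
          (if LargeSector.HasSystem m ρ A C α (φ α) then φ α else R α) := by
        split_ifs with h
        · exact h
        · exact hRs α hα
      exact this
  · exact ⟨R, fun α _ => hR0 α, fun h => absurd h hT, fun α hα => hRs α hα⟩
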